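/- Let $M$ be a compact smooth manifold without boundary (Hausdorff and finite-dimensional), let $\mathfrak{k}$ and $\mathfrak{g}$ be finite-dimensional real Lie algebras, and assume that $\mathfrak{g}$ is simple and that its complexification $\mathfrak{g}_{\mathbb{C}}=\mathbb{C}\otimes_{\mathbb{R}}\mathfrak{g}$ is a simple complex Lie algebra. Let $C^\infty(M,\mathfrak{g})$ be the real Lie algebra of smooth maps $M\to\mathfrak{g}$ with the pointwise bracket, and let $\mathcal{V}(M)$ be the Lie algebra of smooth vector fields on $M$, which acts on $C^\infty(M,\mathfrak{g})$ by the derivations $X\cdot f=df(X)$. Then for every Lie algebra extension, i.e. every short exact sequence of real Lie algebras $$0\to C^\infty(M,\mathfrak{g})\xrightarrow{\ i\ }\widehat{\mathfrak{k}}\xrightarrow{\ p\ }\mathfrak{k}\to 0,$$ there are a Lie algebra homomorphism $r:\mathfrak{k}\to\mathcal{V}(M)$ and an isomorphism of Lie algebras $$\Phi: C^\infty(M,\mathfrak{g})\rtimes\mathfrak{k}\to\widehat{\mathfrak{k}},$$ where $\mathfrak{k}$ acts on $C^\infty(M,\mathfrak{g})$ through the composition $\mathfrak{k}\xrightarrow{r}\mathcal{V}(M)\to\operatorname{der}(C^\infty(M,\mathfrak{g}))$,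 such that $\Phi(f,0)=i(f)$ for all $f\in C^\infty(M,\mathfrak{g})$ and $p(\Phi(f,x))=x$ for all $(f,x)$; that is, $\Phi$ is an isomorphism of extensions from $C^\infty(M,\mathfrak{g})\to C^\infty(M,\mathfrak{g})\rtimes\mathfrak{k}\to\mathfrak{k}$ to the given one, inducing the identity on both ends. If moreover $\widehat{\mathfrak{k}}$ carries a vector space topology for which $p$ is continuous and $i$ is a topological embedding, where $C^\infty(M,\mathfrak{g})$ carries the $C^\infty$-topology and $\mathfrak{k}$ its Hausdorff vector space topology, then $\Phi$ is a homeomorphism for the product topology on $C^\infty(M,\mathfrak{g})\times\mathfrak{k}$. -/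

import Mathlib

open scoped Manifold ContDiff TensorProduct Topology

set_option linter.unusedSectionVars false

noncomputable section

namespace CurrentExt

/-! ### Smooth maps with values in a finite-dimensional real vector space -/

section SmoothMaps

variable {E : Type*} [NormedAddCommGroup E] [NormedSpace ℝ E]
  {H : Type*} [TopologicalSpace H] (I : ModelWithCorners ℝ E H)
  {M : Type*} [TopologicalSpace M] [ChartedSpace H M]
  {V : Type*} [AddCommGroup V] [Module ℝ V]

/-- A map from a manifold to a finite-dimensional real vector space is smooth if its composite
with every linear functional is smooth (equivalently: all coordinates in a basis are smooth). -/
def IsSmoothMap (f : M → V) : Prop :=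
  ∀ l : V →ₗ[ℝ] ℝ, ContMDiff I 𝓘(ℝ, ℝ) ∞ (fun x => l (f x))

variable {I}

theorem isSmoothMap_of_basis {ι : Type*} [Fintype ι] (b : Module.Basis ι ℝ V) {f : M → V}
    (h : ∀ i, ContMDiff I 𝓘(ℝ, ℝ) ∞ (fun x => b.repr (f x) i)) : IsSmoothMap I f := by
  intro l
  have h1 : (fun x => l (f x)) = fun x => ∑ i, b.repr (f x) i * l (b i) := by
    funext x
    conv_lhs => rw [← b.sum_repr (f x)]
    rw [map_sum]
    simp only [map_smul, smul_eq_mul]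
  rw [h1]
  exact ContMDiff.sum fun i _ => (h i).mul contMDiff_const

/-- For any norm on the target, this is Mathlib's notion of smoothness. -/
theorem isSmoothMap_iff_contMDiff {F : Type*} [NormedAddCommGroup F] [NormedSpace ℝ F]
    [FiniteDimensional ℝ F] {f : M → F} :
    IsSmoothMap I f ↔ ContMDiff I 𝓘(ℝ, F) ∞ f := by
  constructor
  · intro h
    let b := Module.finBasis ℝ F
    have h1 : f = fun x => ∑ i, b.repr (f x) i • b i := by
      funext x
      exact (b.sum_repr (f x)).symm
    rw [h1]
    exact ContMDiff.sum fun i _ => (h (b.coord i)).smul contMDiff_const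
  · intro h l
    exact (LinearMap.toContinuousLinearMap l).contMDiff.comp h

variable (I)

/-- The derivative `df(X)` of a map `f` with values in a finite-dimensional vector space along the
vector field `X`, computed coordinatewise. -/
def dirDeriv [FiniteDimensional ℝ V] (X : ∀ x : M, TangentSpace I x) (f : M → V) (x : M) : V :=
  ∑ i, mvfderiv I (fun y => (Module.finBasis ℝ V).repr (f y) i) x (X x) • Module.finBasis ℝ V i

variable {I}

theorem mvfderiv_clm_comp {F F' : Type*} [NormedAddCommGroup F] [NormedSpace ℝ F]
    [NormedAddCommGroup F'] [NormedSpace ℝ F'] (L : F →L[ℝ] F') {f : M → F} {x : M}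
    (hf : MDifferentiableAt I 𝓘(ℝ, F) f x) (v : TangentSpace I x) :
    mvfderiv I (fun y => L (f y)) x v = L (mvfderiv I f x v) := by
  have h : HasMFDerivAt I 𝓘(ℝ, F') (fun y => L (f y)) x (L.comp (mfderiv I 𝓘(ℝ, F) f x)) :=
    HasMFDerivAt.comp x L.hasMFDerivAt hf.hasMFDerivAt
  have h2 := h.mfderiv
  change mfderiv I 𝓘(ℝ, F') (fun y => L (f y)) x v = L (mfderiv I 𝓘(ℝ, F) f x v)
  rw [h2]
  rfl

theorem isSmoothMap_equivFun [FiniteDimensional ℝ V] {f : M → V} (hf : IsSmoothMap I f) :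
    ContMDiff I 𝓘(ℝ, Fin (Module.finrank ℝ V) → ℝ) ∞
      (fun x => (Module.finBasis ℝ V).equivFun (f x)) := by
  rw [contMDiff_pi_space]
  exact fun i => hf ((Module.finBasis ℝ V).coord i)

theorem apply_dirDeriv [FiniteDimensional ℝ V] (X : ∀ x : M, TangentSpace I x) {f : M → V}
    (hf : IsSmoothMap I f) (l : V →ₗ[ℝ] ℝ) (x : M) :
    l (dirDeriv I X f x) = mvfderiv I (fun y => l (f y)) x (X x) := by
  set b := Module.finBasis ℝ V with hb
  have hd : MDifferentiableAt I 𝓘(ℝ, Fin (Module.finrank ℝ V) → ℝ)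
      (fun x => b.equivFun (f x)) x :=
    (isSmoothMap_equivFun hf).mdifferentiable (by simp) x
  have h1 : dirDeriv I X f x = b.equivFun.symm (mvfderiv I (fun y => b.equivFun (f y)) x (X x)) := by
    rw [Module.Basis.equivFun_symm_apply]
    refine Finset.sum_congr rfl fun i _ => ?_
    congr 1
    exact mvfderiv_clm_comp (ContinuousLinearMap.proj (R := ℝ) (φ := fun _ => ℝ) i) hd (X x)
  have h2 := mvfderiv_clm_comp
    (LinearMap.toContinuousLinearMap (l ∘ₗ b.equivFun.symm.toLinearMap)) hd (X x)
  rw [h1]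
  simp only [LinearMap.coe_toContinuousLinearMap', LinearMap.comp_apply, LinearEquiv.coe_coe,
    LinearEquiv.symm_apply_apply] at h2
  exact h2.symm

/-- For any norm on the target, `dirDeriv` is Mathlib's derivative. -/
theorem dirDeriv_eq_mvfderiv {F : Type*} [NormedAddCommGroup F] [NormedSpace ℝ F]
    [FiniteDimensional ℝ F] (X : ∀ x : M, TangentSpace I x) {f : M → F}
    (hf : IsSmoothMap I f) (x : M) :
    dirDeriv I X f x = mvfderiv I f x (X x) := by
  have hd : MDifferentiableAt I 𝓘(ℝ, F) f x :=
    (isSmoothMap_iff_contMDiff.1 hf).mdifferentiable (by simp) x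
  refine (Module.finBasis ℝ F).ext_elem fun i => ?_
  have h1 := apply_dirDeriv X hf ((Module.finBasis ℝ F).coord i) x
  have h2 := mvfderiv_clm_comp
    (LinearMap.toContinuousLinearMap ((Module.finBasis ℝ F).coord i)) hd (X x)
  exact h1.trans h2

theorem contMDiff_mvfderiv_apply [IsManifold I ∞ M] {f : M → ℝ} (hf : ContMDiff I 𝓘(ℝ, ℝ) ∞ f)
    {X : ∀ x : M, TangentSpace I x}
    (hX : ContMDiff I I.tangent ∞ (fun x => (⟨x, X x⟩ : TangentBundle I M))) :
    ContMDiff I 𝓘(ℝ, ℝ) ∞ (fun x => mvfderiv I f x (X x)) := by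
  have : IsManifold I 1 M := IsManifold.of_le (n := ∞) (by simp)
  have h1 : ContMDiff I.tangent 𝓘(ℝ, ℝ).tangent ∞ (tangentMap I 𝓘(ℝ, ℝ) f) :=
    hf.contMDiff_tangentMap (by simp)
  exact (contMDiff_snd_tangentBundle_modelSpace ℝ 𝓘(ℝ, ℝ)).comp (h1.comp hX)

theorem isSmoothMap_dirDeriv [FiniteDimensional ℝ V] [IsManifold I ∞ M]
    {X : ∀ x : M, TangentSpace I x}
    (hX : ContMDiff I I.tangent ∞ (fun x => (⟨x, X x⟩ : TangentBundle I M)))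
    {f : M → V} (hf : IsSmoothMap I f) : IsSmoothMap I (dirDeriv I X f) := by
  intro l
  simp only [apply_dirDeriv X hf l]
  exact contMDiff_mvfderiv_apply (hf l) hX

end SmoothMaps

/-! ### The Lie algebra of smooth vector fields -/

section VectorFields

variable {E : Type*} [NormedAddCommGroup E] [NormedSpace ℝ E] [FiniteDimensional ℝ E]
  {H : Type*} [TopologicalSpace H] (I : ModelWithCorners ℝ E H)
  (M : Type*) [TopologicalSpace M] [ChartedSpace H M] [IsManifold I ∞ M]

/-- Smooth vector fields: smooth sections of the tangent bundle. -/
abbrev SmoothVectorField : Type _ :=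
  ContMDiffSection I E ∞ (TangentSpace I : M → Type _)

theorem min_le_infty (n : ℕ) : minSmoothness ℝ n ≤ ∞ := by
  rw [minSmoothness_of_isRCLikeNormedField]
  exact_mod_cast le_top (a := (n : ℕ∞))

theorem isManifold_min (n : ℕ) : IsManifold I (minSmoothness ℝ n) M :=
  IsManifold.of_le (n := ∞) (min_le_infty n)

variable {I M}

theorem SmoothVectorField.mdifferentiableAt (X : SmoothVectorField I M) (x : M) :
    MDifferentiableAt I I.tangent (fun y => (⟨y, X y⟩ : TangentBundle I M)) x :=
  X.contMDiff.mdifferentiable (by simp) x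

instance : Bracket (SmoothVectorField I M) (SmoothVectorField I M) where
  bracket X Y := ⟨VectorField.mlieBracket I X Y, by
    have : IsManifold I (((⊤ : ℕ∞) : ℕ∞ω) + 1) M := inferInstanceAs (IsManifold I ∞ M)
    have := isManifold_min I M 2
    exact ContDiff.mlieBracket_vectorField (m := ⊤) (n := ⊤) X.contMDiff Y.contMDiff (by simp)⟩

theorem SmoothVectorField.lie_apply (X Y : SmoothVectorField I M) (x : M) :
    ⁅X, Y⁆ x = VectorField.mlieBracket I X Y x := rfl

instance : LieRing (SmoothVectorField I M) where
  add_lie X Y Z := by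
    ext x
    exact VectorField.mlieBracket_add_left (X.mdifferentiableAt x) (Y.mdifferentiableAt x)
  lie_add X Y Z := by
    ext x
    exact VectorField.mlieBracket_add_right (Y.mdifferentiableAt x) (Z.mdifferentiableAt x)
  lie_self X := by
    ext x
    simp [SmoothVectorField.lie_apply]
  leibniz_lie X Y Z := by
    have := isManifold_min I M 3
    have h2 := min_le_infty 2
    ext x
    exact VectorField.leibniz_identity_mlieBracket_apply ((X.contMDiff x).of_le h2)
      ((Y.contMDiff x).of_le h2) ((Z.contMDiff x).of_le h2)

instance : LieAlgebra ℝ (SmoothVectorField I M) where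
  lie_smul c X Y := by
    ext x
    exact VectorField.mlieBracket_const_smul_right (Y.mdifferentiableAt x)

/-- The Lie bracket of vector fields acts on functions as the commutator. -/
theorem mvfderiv_lie (X Y : SmoothVectorField I M) {f : M → ℝ} (hf : ContMDiff I 𝓘(ℝ, ℝ) ∞ f)
    (x : M) :
    mvfderiv I f x (⁅X, Y⁆ x) =
      mvfderiv I (fun y => mvfderiv I f y (Y y)) x (X x) -
        mvfderiv I (fun y => mvfderiv I f y (X y)) x (Y x) := by
  have hM3 := isManifold_min I M 3
  have hM2 := isManifold_min I M 2
  have hM1 : IsManifold I 1 M := IsManifold.of_le (n := ∞) (by simp)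
  have h2 := min_le_infty 2
  rcases subsingleton_or_nontrivial E with hE | hE
  · have hz : ∀ (y : M) (v : TangentSpace I y) (g : M → ℝ), mvfderiv I g y v = 0 := by
      intro y v g
      have : v = 0 := Subsingleton.elim (α := E) v 0
      rw [this, map_zero]
    simp [hz]
  obtain ⟨w, hw⟩ := exists_ne (0 : E)
  set W : ∀ y : M, TangentSpace I y :=
    FiberBundle.extend E (E := (TangentSpace I : M → Type _)) (x := x) w with hWdef
  have hWx : W x = w := FiberBundle.extend_apply_self ..
  obtain ⟨s, hs, hWs⟩ : ∃ s ∈ 𝓝 x,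
      ContMDiffOn I I.tangent ∞ (fun y => (⟨y, W y⟩ : TangentBundle I M)) s :=
    FiberBundle.exists_contMDiffOn_extend (I := I) E (V := (TangentSpace I : M → Type _)) (x₀ := x) w
  obtain ⟨u, hus, hu, hxu⟩ := mem_nhds_iff.1 hs
  have hWu : ∀ y ∈ u, ContMDiffAt I I.tangent ∞ (fun y => (⟨y, W y⟩ : TangentBundle I M)) y :=
    fun y hy => hWs.contMDiffAt (Filter.mem_of_superset (hu.mem_nhds hy) hus)
  have hWd : ∀ y ∈ u, MDifferentiableAt I I.tangent
      (fun y => (⟨y, W y⟩ : TangentBundle I M)) y :=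
    fun y hy => (hWu y hy).mdifferentiableAt (by simp)
  have hfd : ∀ y, MDifferentiableAt I 𝓘(ℝ, ℝ) f y := fun y => hf.mdifferentiable (by simp) y
  have hder : ∀ (Z : SmoothVectorField I M) (y : M),
      MDifferentiableAt I 𝓘(ℝ, ℝ) (fun y => mvfderiv I f y (Z y)) y := fun Z y =>
    (contMDiff_mvfderiv_apply hf Z.contMDiff).mdifferentiable (by simp) y
  have hbr : ∀ Z : SmoothVectorField I M, MDifferentiableAt I I.tangent
      (fun y => (⟨y, VectorField.mlieBracket I Z W y⟩ : TangentBundle I M)) x := by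
    intro Z
    have : IsManifold I (((⊤ : ℕ∞) : ℕ∞ω) + 1) M := inferInstanceAs (IsManifold I ∞ M)
    have h := ContMDiffAt.mlieBracket_vectorField (m := ⊤) (n := ⊤) (Z.contMDiff x) (hWu x hxu)
      (by simp)
    exact h.mdifferentiableAt (by simp)
  have hfW : ContMDiffAt I I.tangent ∞ (fun y => (⟨y, (f • W) y⟩ : TangentBundle I M)) x :=
    ContMDiffAt.smul_section (hf x) (hWu x hxu)
  have key : ∀ A B : SmoothVectorField I M,
      VectorField.mlieBracket I A (VectorField.mlieBracket I B (f • W)) x =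
        (mvfderiv I (fun y => mvfderiv I f y (B y)) x (A x) • W x +
          mvfderiv I f x (B x) • VectorField.mlieBracket I A W x) +
        (mvfderiv I f x (A x) • VectorField.mlieBracket I B W x +
          f x • VectorField.mlieBracket I A (VectorField.mlieBracket I B W) x) := by
    intro A B
    have he : VectorField.mlieBracket I B (f • W) =ᶠ[𝓝 x]
        (fun y => mvfderiv I f y (B y)) • W + f • VectorField.mlieBracket I B W := by
      filter_upwards [hu.mem_nhds hxu] with y hy
      exact VectorField.mlieBracket_smul_right (hfd y) (hWd y hy)
    have he2 := Filter.EventuallyEq.mlieBracket_vectorField_eq (I := I)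
      (Filter.EventuallyEq.refl (𝓝 x) (A : ∀ y : M, TangentSpace I y)) he
    rw [he2,
      VectorField.mlieBracket_add_right ((hder B x).smul_section (hWd x hxu))
        ((hfd x).smul_section (hbr B)),
      VectorField.mlieBracket_smul_right (hder B x) (hWd x hxu),
      VectorField.mlieBracket_smul_right (hfd x) (hbr B)]
  have hJ := VectorField.leibniz_identity_mlieBracket_apply ((X.contMDiff x).of_le h2)
    ((Y.contMDiff x).of_le h2) (hfW.of_le h2)
  have hJW := VectorField.leibniz_identity_mlieBracket_apply ((X.contMDiff x).of_le h2)
    ((Y.contMDiff x).of_le h2) ((hWu x hxu).of_le h2)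
  rw [key X Y, key Y X, VectorField.mlieBracket_smul_right (hfd x) (hWd x hxu), hJW] at hJ
  have h0 : (mvfderiv I f x (⁅X, Y⁆ x) - (mvfderiv I (fun y => mvfderiv I f y (Y y)) x (X x) -
        mvfderiv I (fun y => mvfderiv I f y (X y)) x (Y x))) • W x = 0 := by
    rw [SmoothVectorField.lie_apply]
    rw [← sub_eq_zero] at hJ
    rw [← neg_eq_zero, ← hJ]
    module
  rcases smul_eq_zero.1 h0 with h | h
  · exact sub_eq_zero.1 h
  · exact absurd (hWx.symm.trans h) hw

end VectorFields

/-! ### The Lie algebra `C^∞(M, g)` -/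

section CurrentAlgebra

variable {E : Type*} [NormedAddCommGroup E] [NormedSpace ℝ E]
  {H : Type*} [TopologicalSpace H] (I : ModelWithCorners ℝ E H)
  (M : Type*) [TopologicalSpace M] [ChartedSpace H M]
  (g : Type*) [LieRing g] [LieAlgebra ℝ g]

/-- The vector space of smooth maps `M → g`, with pointwise operations. -/
def smoothMaps : Submodule ℝ (M → g) where
  carrier := {f | IsSmoothMap I f}
  zero_mem' l := by simpa using contMDiff_const
  add_mem' hf hh l := by
    simp only [Pi.add_apply, map_add]
    exact (hf l).add (hh l)
  smul_mem' c f hf l := by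
    simp only [Pi.smul_apply, map_smul, smul_eq_mul]
    exact contMDiff_const.mul (hf l)

/-- The current algebra `C^∞(M, g)`. -/
abbrev CurrentAlgebra : Type _ := smoothMaps I M g

variable {I M g}

theorem lie_coord_eq [FiniteDimensional ℝ g] (l : g →ₗ[ℝ] ℝ) (u v : g) :
    l ⁅u, v⁆ = ∑ i, ∑ j, ((Module.finBasis ℝ g).coord i u * (Module.finBasis ℝ g).coord j v) *
      l ⁅Module.finBasis ℝ g i, Module.finBasis ℝ g j⁆ := by
  conv_lhs => rw [← (Module.finBasis ℝ g).sum_repr u, ← (Module.finBasis ℝ g).sum_repr v]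
  simp only [sum_lie, lie_sum, smul_lie, lie_smul, map_sum, map_smul,
    smul_eq_mul, Module.Basis.coord_apply, Finset.mul_sum]
  rw [Finset.sum_comm]
  exact Finset.sum_congr rfl fun i _ => Finset.sum_congr rfl fun j _ => by ring

theorem isSmoothMap_lie [FiniteDimensional ℝ g] {f h : M → g} (hf : IsSmoothMap I f)
    (hh : IsSmoothMap I h) : IsSmoothMap I (fun x => ⁅f x, h x⁆) := by
  intro l
  rw [funext fun x => lie_coord_eq l (f x) (h x)]
  exact ContMDiff.sum fun i _ => ContMDiff.sum fun j _ =>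
    ((hf _).mul (hh _)).mul contMDiff_const

instance [FiniteDimensional ℝ g] : Bracket (CurrentAlgebra I M g) (CurrentAlgebra I M g) where
  bracket f h := ⟨fun x => ⁅f.1 x, h.1 x⁆, isSmoothMap_lie f.2 h.2⟩

theorem CurrentAlgebra.lie_apply [FiniteDimensional ℝ g] (f h : CurrentAlgebra I M g) (x : M) :
    (⁅f, h⁆ : CurrentAlgebra I M g).1 x = ⁅f.1 x, h.1 x⁆ := rfl

instance [FiniteDimensional ℝ g] : LieRing (CurrentAlgebra I M g) where
  add_lie _ _ _ := Subtype.ext (funext fun _ => add_lie _ _ _)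
  lie_add _ _ _ := Subtype.ext (funext fun _ => lie_add _ _ _)
  lie_self _ := Subtype.ext (funext fun _ => lie_self _)
  leibniz_lie _ _ _ := Subtype.ext (funext fun _ => leibniz_lie _ _ _)

instance [FiniteDimensional ℝ g] : LieAlgebra ℝ (CurrentAlgebra I M g) where
  lie_smul _ _ _ := Subtype.ext (funext fun _ => lie_smul _ _ _)

/-- The `C^∞`-topology on `C^∞(M, g)`: locally uniform convergence, in the charts of `M` and the
coordinates of `g`, of all iterated derivatives. -/
instance : TopologicalSpace (CurrentAlgebra I M g) :=
  ⨅ (l : g →ₗ[ℝ] ℝ) (x : M) (n : ℕ), TopologicalSpace.induced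
    (fun f => UniformOnFun.ofFun {K : Set E | IsCompact K ∧ K ⊆ (extChartAt I x).target}
      (iteratedFDerivWithin ℝ n (fun y => l (f.1 ((extChartAt I x).symm y))) (Set.range I)))
    inferInstance

theorem mvfderiv_sum {ι : Type*} (s : Finset ι) {f : ι → M → ℝ} {x : M}
    (hf : ∀ i ∈ s, MDifferentiableAt I 𝓘(ℝ, ℝ) (f i) x) (v : TangentSpace I x) :
    mvfderiv I (fun y => ∑ i ∈ s, f i y) x v = ∑ i ∈ s, mvfderiv I (f i) x v := by
  classical
  have : MDifferentiableAt I 𝓘(ℝ, ℝ) (fun y => ∑ i ∈ s, f i y) x ∧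
      mvfderiv I (fun y => ∑ i ∈ s, f i y) x v = ∑ i ∈ s, mvfderiv I (f i) x v := by
    induction s using Finset.induction_on with
    | empty =>
      simp only [Finset.sum_empty]
      exact ⟨mdifferentiableAt_const, by rw [mvfderiv_const]; rfl⟩
    | insert i s hi ih =>
      obtain ⟨h1, h2⟩ := ih fun j hj => hf j (Finset.mem_insert_of_mem hj)
      have h3 := hf i (Finset.mem_insert_self i s)
      simp only [Finset.sum_insert hi]
      refine ⟨h3.add h1, ?_⟩
      have h4 := mvfderiv_add h3 h1
      rw [← h2]
      exact congrArg (fun L => L v) h4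
  exact this.2

theorem dirDeriv_lie [FiniteDimensional ℝ g] (X : ∀ x : M, TangentSpace I x) {f h : M → g}
    (hf : IsSmoothMap I f) (hh : IsSmoothMap I h) (x : M) :
    dirDeriv I X (fun y => ⁅f y, h y⁆) x =
      ⁅dirDeriv I X f x, h x⁆ + ⁅f x, dirDeriv I X h x⁆ := by
  refine (Module.finBasis ℝ g).ext_elem fun k => ?_
  set l := (Module.finBasis ℝ g).coord k with hl
  change l _ = l _
  rw [apply_dirDeriv X (isSmoothMap_lie hf hh), map_add]
  rw [funext fun y => lie_coord_eq l (f y) (h y), lie_coord_eq l, lie_coord_eq l]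
  have hfd : ∀ i, MDifferentiableAt I 𝓘(ℝ, ℝ)
      (fun y => (Module.finBasis ℝ g).coord i (f y)) x :=
    fun i => (hf _).mdifferentiable (by simp) x
  have hhd : ∀ i, MDifferentiableAt I 𝓘(ℝ, ℝ)
      (fun y => (Module.finBasis ℝ g).coord i (h y)) x :=
    fun i => (hh _).mdifferentiable (by simp) x
  have hc : ∀ c : ℝ, MDifferentiableAt I 𝓘(ℝ, ℝ) (fun _ : M => c) x :=
    fun c => mdifferentiableAt_const
  have hS : ∀ i j, ContMDiff I 𝓘(ℝ, ℝ) ∞ (fun y => (Module.finBasis ℝ g).coord i (f y) *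
      (Module.finBasis ℝ g).coord j (h y) *
        l ⁅Module.finBasis ℝ g i, Module.finBasis ℝ g j⁆) := fun i j =>
    ((hf _).mul (hh _)).mul contMDiff_const
  have hT : ∀ i, ContMDiff I 𝓘(ℝ, ℝ) ∞ (fun y => ∑ j, (Module.finBasis ℝ g).coord i (f y) *
      (Module.finBasis ℝ g).coord j (h y) *
        l ⁅Module.finBasis ℝ g i, Module.finBasis ℝ g j⁆) := fun i =>
    ContMDiff.sum fun j _ => hS i j
  rw [mvfderiv_sum _ fun i _ => (hT i).mdifferentiable (by simp) x, ← Finset.sum_add_distrib]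
  refine Finset.sum_congr rfl fun i _ => ?_
  rw [mvfderiv_sum _ fun j _ => (hS i j).mdifferentiable (by simp) x, ← Finset.sum_add_distrib]
  refine Finset.sum_congr rfl fun j _ => ?_
  have e1 := mvfderiv_mul ((hfd i).mul (hhd j))
    (hc (l ⁅Module.finBasis ℝ g i, Module.finBasis ℝ g j⁆))
  have e2 := mvfderiv_mul (hfd i) (hhd j)
  have e3 := congrArg (fun L => L (X x)) e1
  rw [apply_dirDeriv X hf, apply_dirDeriv X hh]
  refine e3.trans ?_
  rw [mvfderiv_const, e2]
  simp only [smul_zero, zero_add, _root_.add_apply, _root_.smul_apply,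
    smul_eq_mul]
  ring

end CurrentAlgebra

/-! ### The natural action of vector fields on `C^∞(M, g)` -/

section Action

variable {E : Type*} [NormedAddCommGroup E] [NormedSpace ℝ E] [FiniteDimensional ℝ E]
  {H : Type*} [TopologicalSpace H] (I : ModelWithCorners ℝ E H)
  (M : Type*) [TopologicalSpace M] [ChartedSpace H M] [IsManifold I ∞ M]
  (g : Type*) [LieRing g] [LieAlgebra ℝ g] [FiniteDimensional ℝ g]

variable {I M g} in
theorem CurrentAlgebra.ext_coord {f h : CurrentAlgebra I M g}
    (H : ∀ (l : g →ₗ[ℝ] ℝ) (x : M), l (f.1 x) = l (h.1 x)) : f = h :=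
  Subtype.ext (funext fun x => (Module.finBasis ℝ g).ext_elem fun i =>
    H ((Module.finBasis ℝ g).coord i) x)

/-- A vector field `X` acts on `C^∞(M, g)` by the derivation `f ↦ df(X)`. -/
def vectorFieldDerivation (X : SmoothVectorField I M) :
    LieDerivation ℝ (CurrentAlgebra I M g) (CurrentAlgebra I M g) where
  toFun f := ⟨dirDeriv I X f.1, isSmoothMap_dirDeriv X.contMDiff f.2⟩
  map_add' f h := CurrentAlgebra.ext_coord fun l x => by
    have hf := (f.2 l).mdifferentiable (by simp) x
    have hh := (h.2 l).mdifferentiable (by simp) x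
    have e := congrArg (fun L => L (X x)) (mvfderiv_add hf hh)
    change l (dirDeriv I X (f + h).1 x) = l (dirDeriv I X f.1 x + dirDeriv I X h.1 x)
    rw [map_add, apply_dirDeriv _ (f + h).2, apply_dirDeriv _ f.2, apply_dirDeriv _ h.2]
    simp only [Submodule.coe_add, Pi.add_apply, map_add]
    exact e
  map_smul' c f := CurrentAlgebra.ext_coord fun l x => by
    have hf := (f.2 l).mdifferentiable (by simp) x
    have e := mvfderiv_clm_comp (c • ContinuousLinearMap.id ℝ ℝ) hf (X x)
    change l (dirDeriv I X (c • f).1 x) = l (c • dirDeriv I X f.1 x)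
    rw [map_smul, apply_dirDeriv _ (c • f).2, apply_dirDeriv _ f.2]
    simp only [Submodule.coe_smul, Pi.smul_apply, map_smul]
    exact e
  leibniz' f h := Subtype.ext (funext fun x => by
    refine (dirDeriv_lie X f.2 h.2 x).trans ?_
    change _ = ⁅f.1 x, dirDeriv I X h.1 x⁆ - ⁅h.1 x, dirDeriv I X f.1 x⁆
    rw [← lie_skew (dirDeriv I X f.1 x) (h.1 x)]
    abel)

/-- The natural action `V(M) → der(C^∞(M, g))`, a homomorphism of Lie algebras. -/
def vectorFieldAction :
    SmoothVectorField I M →ₗ⁅ℝ⁆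
      LieDerivation ℝ (CurrentAlgebra I M g) (CurrentAlgebra I M g) where
  toFun X := vectorFieldDerivation I M g X
  map_add' X Y := LieDerivation.ext fun f => CurrentAlgebra.ext_coord fun l x => by
    change l (dirDeriv I _ f.1 x) = l (dirDeriv I _ f.1 x + dirDeriv I _ f.1 x)
    rw [map_add, apply_dirDeriv _ f.2, apply_dirDeriv _ f.2, apply_dirDeriv _ f.2]
    exact map_add _ _ _
  map_smul' c X := LieDerivation.ext fun f => CurrentAlgebra.ext_coord fun l x => by
    change l (dirDeriv I _ f.1 x) = l (c • dirDeriv I _ f.1 x)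
    rw [map_smul, apply_dirDeriv _ f.2, apply_dirDeriv _ f.2]
    exact map_smul _ _ _
  map_lie' {X Y} := LieDerivation.ext fun f => CurrentAlgebra.ext_coord fun l x => by
    rw [LieDerivation.commutator_apply]
    change l (dirDeriv I _ f.1 x) =
      l (dirDeriv I X (dirDeriv I Y f.1) x - dirDeriv I Y (dirDeriv I X f.1) x)
    rw [map_sub, apply_dirDeriv _ f.2, apply_dirDeriv _ (isSmoothMap_dirDeriv Y.contMDiff f.2),
      apply_dirDeriv _ (isSmoothMap_dirDeriv X.contMDiff f.2), mvfderiv_lie X Y (f.2 l)]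
    simp only [apply_dirDeriv _ f.2]

theorem vectorFieldAction_apply (X : SmoothVectorField I M) (f : CurrentAlgebra I M g) (x : M) :
    (vectorFieldAction I M g X f).1 x = dirDeriv I X f.1 x := rfl

end Action

end CurrentExt
end

/-!
# Extensions by the current algebra `C^∞(M, g)`

An extension of `k` by a Lie algebra `K` makes the total algebra `L` act on `K` by derivations, and
`L` can be read off from this action when the derivations of `K` are well understood. Suppose that
every derivation of `K` is `ad f + ρ X` for exactly one `f` in `K` and one `X` in a Lie algebra `V`
acting on `K` through `ρ`; in other words, `K ⋊ V → der K` is an isomorphism. Then `L → der K` has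
components `l ↦ f l` and `l ↦ X l`; the second one kills the image of `K`, hence factors through a
homomorphism `r : k → V`, and `l ↦ (f l, p l)` is an isomorphism `L → K ⋊ k`
(`CurrentExt.exists_semiDirectSum_equiv`). It restricts to a linear section `k → L`, which is
continuous for every vector space topology on `L` because `k` is finite-dimensional; so an extension
of topological Lie algebras splits topologically (`CurrentExt.isHomeomorph_of_splitting`).

It remains to see that `K = C^∞(M, g)` and `V = V(M)` have this property
(`CurrentExt.bijective_ad_add_vectorFieldAction`). Let `D` be a derivation of `K`.

* For a smooth function `a`, the commutator of `D` with the multiplication by `a` commutes with the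
  adjoint representation. As `g` is perfect, such an operator is linear over the smooth functions,
  so it acts pointwise through the centroid of `g`; the latter is `ℝ`, because the complexification
  of `g` is simple (`CurrentExt.exists_eq_smul_of_lie_comm`). So the commutator is the
  multiplication by a smooth function `δ a` (`CurrentExt.exists_derivation_fun`).
* The map `δ` is a derivation of the algebra of smooth functions, hence a smooth vector field `X`
  (`CurrentExt.exists_smoothVectorField`). This rests on Hadamard's lemma: modulo constants and
  products of two functions vanishing at a point, a smooth function is determined by its
  differential at this point.
* The derivation `D - X` is linear over the smooth functions, so it acts pointwise by derivations
  of `g`, which are inner by Cartan's criterion (`CurrentExt.exists_eq_lie_of_fun_linear`).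
-/

noncomputable section

namespace CurrentExt

/-! ### Simple Lie algebras: commutators, derivations and the centroid -/

section SimpleLie

variable {g : Type*} [LieRing g] [LieAlgebra ℝ g]

theorem span_commutators_eq_top (hg : LieAlgebra.IsSimple ℝ g) :
    Submodule.span ℝ {w : g | ∃ u v : g, ⁅u, v⁆ = w} = ⊤ := by
  have h := LieSubmodule.lieIdeal_oper_eq_linear_span' (R := ℝ) (⊤ : LieIdeal ℝ g)
    (⊤ : LieIdeal ℝ g)
  simp only [LieSubmodule.mem_top, true_and] at h
  rw [← h]
  rcases hg.eq_bot_or_eq_top ⁅(⊤ : LieIdeal ℝ g), (⊤ : LieIdeal ℝ g)⁆ with h0 | h0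
  · refine absurd ?_ hg.non_abelian
    refine ⟨fun u v => ?_⟩
    have : ⁅u, v⁆ ∈ ⁅(⊤ : LieIdeal ℝ g), (⊤ : LieIdeal ℝ g)⁆ :=
      LieSubmodule.lie_mem_lie (LieSubmodule.mem_top u) (LieSubmodule.mem_top v)
    rw [h0] at this
    simpa using this
  · rw [h0]
    rfl

theorem eq_zero_of_forall_lie_eq_zero (hg : LieAlgebra.IsSimple ℝ g) {u : g}
    (hu : ∀ v : g, ⁅u, v⁆ = 0) : u = 0 := by
  have h : u ∈ LieAlgebra.center ℝ g := by
    rw [LieModule.mem_maxTrivSubmodule]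
    intro v
    rw [← lie_skew, hu, neg_zero]
  simpa using h

/-- Derivations of a simple Lie algebra are inner: its Killing form is nondegenerate by Cartan's
criterion. -/
theorem exists_forall_lie_eq [FiniteDimensional ℝ g] (hg : LieAlgebra.IsSimple ℝ g)
    (D : LieDerivation ℝ g g) : ∃ u : g, ∀ v, D v = ⁅u, v⁆ := by
  obtain ⟨u, hu⟩ := LieDerivation.IsKilling.exists_eq_ad D
  exact ⟨u, fun v => by rw [← hu, LieDerivation.ad_apply_apply]⟩

/-- The centroid of a Lie algebra whose complexification is simple consists of the scalars:
an eigenspace of the complexified operator is a nonzero ideal. -/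
theorem exists_eq_smul_of_lie_comm [FiniteDimensional ℝ g]
    (hgC : LieAlgebra.IsSimple ℂ (ℂ ⊗[ℝ] g)) (S : g →ₗ[ℝ] g)
    (hS : ∀ u v : g, S ⁅u, v⁆ = ⁅u, S v⁆) : ∃ c : ℝ, ∀ v, S v = c • v := by
  have hnt : Nontrivial (ℂ ⊗[ℝ] g) := by
    by_contra hn
    rw [not_nontrivial_iff_subsingleton] at hn
    exact hgC.non_abelian ⟨fun _ _ => Subsingleton.elim _ _⟩
  have hSC : ∀ x y : ℂ ⊗[ℝ] g, S.baseChange ℂ ⁅x, y⁆ = ⁅x, S.baseChange ℂ y⁆ := by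
    intro x y
    induction x with
    | zero => simp
    | add x x' hx hx' => rw [add_lie, map_add, hx, hx', add_lie]
    | tmul z u =>
      induction y with
      | zero =>
        rw [map_zero]
        exact (congrArg _ (lie_zero (z ⊗ₜ[ℝ] u : ℂ ⊗[ℝ] g))).trans
          ((map_zero _).trans (lie_zero (z ⊗ₜ[ℝ] u : ℂ ⊗[ℝ] g)).symm)
      | add y y' hy hy' =>
        rw [map_add]
        refine (congrArg _ (lie_add (z ⊗ₜ[ℝ] u : ℂ ⊗[ℝ] g) y y')).trans
          (Eq.trans ?_ (lie_add (z ⊗ₜ[ℝ] u : ℂ ⊗[ℝ] g) _ _).symm)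
        rw [map_add]
        exact congrArg₂ _ hy hy'
      | tmul w v =>
        rw [LieAlgebra.ExtendScalars.bracket_tmul, LinearMap.baseChange_tmul,
          LinearMap.baseChange_tmul, LieAlgebra.ExtendScalars.bracket_tmul, hS]
  obtain ⟨μ, hμ⟩ := Module.End.exists_eigenvalue (S.baseChange ℂ : Module.End ℂ (ℂ ⊗[ℝ] g))
  let J : LieIdeal ℂ (ℂ ⊗[ℝ] g) :=
    { Module.End.eigenspace (S.baseChange ℂ : Module.End ℂ (ℂ ⊗[ℝ] g)) μ with
      lie_mem := by
        intro x y hy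
        have hy' : S.baseChange ℂ y = μ • y := Module.End.mem_eigenspace_iff.1 hy
        refine Module.End.mem_eigenspace_iff.2 ?_
        rw [hSC, hy']
        exact lie_smul μ x y }
  have hJ : J = ⊤ := by
    refine (hgC.eq_bot_or_eq_top J).resolve_left fun hb => ?_
    obtain ⟨y, hy, hy0⟩ := hμ.exists_hasEigenvector
    have : y ∈ J := hy
    rw [hb] at this
    exact hy0 (by simpa using this)
  have hall : ∀ y : ℂ ⊗[ℝ] g, S.baseChange ℂ y = μ • y := by
    intro y
    have : y ∈ J := by rw [hJ]; exact LieSubmodule.mem_top y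
    exact Module.End.mem_eigenspace_iff.1 this
  -- the real part `ℂ ⊗ g → g` shows that the eigenvalue may be replaced by its real part
  let ρ : ℂ ⊗[ℝ] g →ₗ[ℝ] g :=
    (TensorProduct.lid ℝ g).toLinearMap ∘ₗ TensorProduct.map Complex.reLm LinearMap.id
  refine ⟨μ.re, fun v => ?_⟩
  have h := congrArg ρ (hall (1 ⊗ₜ v))
  rw [LinearMap.baseChange_tmul, TensorProduct.smul_tmul'] at h
  simpa [ρ] using h

end SimpleLie

/-! ### Hadamard's lemma -/

section Hadamard

universe u

/-- Differentiation under the integral sign, iterated. The spaces `E` and `F` share a universe so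
that the induction may replace `F` by `E →L[ℝ] F`. -/
theorem contDiff_intervalIntegral_nat {E : Type u} [NormedAddCommGroup E] [NormedSpace ℝ E]
    [FiniteDimensional ℝ E] (n : ℕ) {F : Type u} [NormedAddCommGroup F] [NormedSpace ℝ F]
    [CompleteSpace F] {h : ℝ × E → F} (hh : ContDiff ℝ ∞ h) :
    ContDiff ℝ n (fun y => ∫ t in (0 : ℝ)..1, h (t, y)) := by
  induction n generalizing F with
  | zero =>
    rw [Nat.cast_zero, contDiff_zero]
    exact intervalIntegral.continuous_parametric_intervalIntegral_of_continuous'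
      (f := fun y t => h (t, y)) (hh.continuous.comp continuous_swap) 0 1
  | succ n ih =>
    let h' : ℝ × E → E →L[ℝ] F := fun q => (fderiv ℝ h q).comp (ContinuousLinearMap.inr ℝ ℝ E)
    have hh' : ContDiff ℝ ∞ h' :=
      (hh.fderiv_right (m := ∞) (by simp)).clm_comp contDiff_const
    have hd : ∀ y, HasFDerivAt (fun y => ∫ t in (0 : ℝ)..1, h (t, y))
        (∫ t in (0 : ℝ)..1, h' (t, y)) y := by
      intro y
      have hK : IsCompact (Set.Icc (0 : ℝ) 1 ×ˢ Metric.closedBall y 1) :=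
        isCompact_Icc.prod (isCompact_closedBall y 1)
      obtain ⟨C, hC⟩ := hK.exists_bound_of_continuousOn hh'.continuous.continuousOn
      have hc : ∀ y, Continuous fun t : ℝ => h (t, y) := fun y =>
        hh.continuous.comp (Continuous.prodMk_left y)
      have hc' : Continuous fun t : ℝ => h' (t, y) :=
        hh'.continuous.comp (Continuous.prodMk_left y)
      refine intervalIntegral.hasFDerivAt_integral_of_dominated_of_fderiv_le
        (F := fun y t => h (t, y)) (F' := fun y t => h' (t, y)) (bound := fun _ => C)
        (Metric.closedBall_mem_nhds y one_pos)
        (Filter.Eventually.of_forall fun y => (hc y).aestronglyMeasurable)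
        ((hc y).intervalIntegrable 0 1) hc'.aestronglyMeasurable
        (Filter.Eventually.of_forall fun t ht x hx => ?_) intervalIntegrable_const
        (Filter.Eventually.of_forall fun t ht x hx => ?_)
      · rw [Set.uIoc_of_le zero_le_one] at ht
        exact hC (t, x) ⟨Set.Ioc_subset_Icc_self ht, hx⟩
      · exact ((hh.differentiable (by simp) (t, x)).hasFDerivAt).comp x
          (hasFDerivAt_prodMk_right t x)
    rw [Nat.cast_add, Nat.cast_one, contDiff_succ_iff_fderiv]
    refine ⟨fun y => (hd y).differentiableAt, by simp, ?_⟩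
    rw [funext fun y => (hd y).fderiv]
    exact ih hh'

/-- Hadamard's lemma: integrate the derivative of `f` along the segment from `c` to `y`. -/
theorem exists_eq_add_apply_sub {E : Type u} [NormedAddCommGroup E] [NormedSpace ℝ E]
    [FiniteDimensional ℝ E] {f : E → ℝ} (hf : ContDiff ℝ ∞ f) (c : E) :
    ∃ G : E → E →L[ℝ] ℝ, ContDiff ℝ ∞ G ∧ G c = fderiv ℝ f c ∧
      ∀ y, f y = f c + G y (y - c) := by
  have hf' : ContDiff ℝ ∞ (fderiv ℝ f) := hf.fderiv_right (m := ∞) (by simp)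
  have hseg : ContDiff ℝ ∞ (fun q : ℝ × E => c + q.1 • (q.2 - c)) := by fun_prop
  refine ⟨fun y => ∫ t in (0 : ℝ)..1, fderiv ℝ f (c + t • (y - c)), ?_, by simp, fun y => ?_⟩
  · rw [contDiff_infty]
    exact fun n => contDiff_intervalIntegral_nat n (hf'.comp hseg)
  · have hcont : Continuous fun t : ℝ => fderiv ℝ f (c + t • (y - c)) :=
      hf'.continuous.comp (by fun_prop)
    have h1 : ∀ t ∈ Set.uIcc (0 : ℝ) 1, HasDerivAt (fun t : ℝ => f (c + t • (y - c)))
        (fderiv ℝ f (c + t • (y - c)) (y - c)) t := by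
      intro t _
      have h2 : HasDerivAt (fun t : ℝ => c + t • (y - c)) (y - c) t := by
        simpa using ((hasDerivAt_id t).smul_const (y - c)).const_add c
      exact (hf.differentiable (by simp) _).hasFDerivAt.comp_hasDerivAt t h2
    have h3 := intervalIntegral.integral_eq_sub_of_hasDerivAt h1
      ((hcont.clm_apply continuous_const).intervalIntegrable 0 1)
    rw [ContinuousLinearMap.intervalIntegral_apply (hcont.intervalIntegrable 0 1), h3]
    simp

end Hadamard

/-! ### Derivations of the algebra of smooth functions -/

section Derivations

variable {E : Type*} [NormedAddCommGroup E] [NormedSpace ℝ E] [FiniteDimensional ℝ E]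
  {M : Type*} [TopologicalSpace M] [ChartedSpace E M] [IsManifold 𝓘(ℝ, E) ∞ M] [T2Space M]

/-- The smooth function on `M` which, in the chart at `x`, is `F` times the bump function `ψ`. -/
def bumpMul {x : M} (ψ : SmoothBumpFunction 𝓘(ℝ, E) x) {F : E → ℝ} (hF : ContDiff ℝ ∞ F) :
    C^∞⟮𝓘(ℝ, E), M; ℝ⟯ :=
  ⟨fun y => ψ y • F (extChartAt 𝓘(ℝ, E) x y),
    ψ.contMDiff_smul (hF.contMDiff.comp_contMDiffOn contMDiffOn_extChartAt)⟩

theorem bumpMul_eventuallyEq {x : M} (ψ : SmoothBumpFunction 𝓘(ℝ, E) x) {F : E → ℝ}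
    (hF : ContDiff ℝ ∞ F) :
    ∀ᶠ y in 𝓝 x, bumpMul ψ hF y = F (extChartAt 𝓘(ℝ, E) x y) := by
  filter_upwards [ψ.eventuallyEq_one] with y hy
  change ψ y • F (extChartAt 𝓘(ℝ, E) x y) = _
  rw [hy, Pi.one_apply, one_smul]

theorem bumpMul_self {x : M} (ψ : SmoothBumpFunction 𝓘(ℝ, E) x) {F : E → ℝ}
    (hF : ContDiff ℝ ∞ F) : bumpMul ψ hF x = F (extChartAt 𝓘(ℝ, E) x x) :=
  (bumpMul_eventuallyEq ψ hF).self_of_nhds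

/-- The germ of a smooth function at `x` is represented, in the chart at `x`, by a smooth function
on the whole model space. -/
theorem exists_contDiff_eventuallyEq (f : C^∞⟮𝓘(ℝ, E), M; ℝ⟯) (x : M) :
    ∃ F : E → ℝ, ContDiff ℝ ∞ F ∧ ∀ᶠ y in 𝓝 x, f y = F (extChartAt 𝓘(ℝ, E) x y) := by
  set φ := extChartAt 𝓘(ℝ, E) x with hφ
  have hT : IsOpen φ.target := isOpen_extChartAt_target x
  have hf : ContDiffOn ℝ ∞ (fun z => f (φ.symm z)) φ.target :=
    (f.contMDiff.comp_contMDiffOn (contMDiffOn_extChartAt_symm x)).contDiffOn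
  obtain ⟨ε, hε, hεT⟩ := Metric.nhds_basis_closedBall.mem_iff.1
    (hT.mem_nhds (mem_extChartAt_target (I := 𝓘(ℝ, E)) x))
  let χ : ContDiffBump (φ x) := ⟨ε / 2, ε, half_pos hε, half_lt_self hε⟩
  refine ⟨fun z => χ z * f (φ.symm z), ?_, ?_⟩
  · rw [contDiff_iff_contDiffAt]
    intro z
    by_cases hz : z ∈ φ.target
    · exact χ.contDiff.contDiffAt.mul (hf.contDiffAt (hT.mem_nhds hz))
    · have hz' : z ∉ tsupport χ := by
        rw [χ.tsupport_eq]
        exact fun h => hz (hεT h)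
      refine (contDiffAt_const (c := (0 : ℝ))).congr_of_eventuallyEq ?_
      filter_upwards [notMem_tsupport_iff_eventuallyEq.1 hz'] with w hw
      rw [hw, Pi.zero_apply, zero_mul]
  · filter_upwards [(continuousAt_extChartAt (I := 𝓘(ℝ, E)) x).eventually χ.eventuallyEq_one,
      extChartAt_source_mem_nhds (I := 𝓘(ℝ, E)) x] with y hy hys
    rw [hy, Pi.one_apply, one_mul, φ.left_inv hys]

theorem mvfderiv_eq_fderiv_of_eventuallyEq {f : M → ℝ} {x : M} {F : E → ℝ}
    (h : ∀ᶠ y in 𝓝 x, f y = F (extChartAt 𝓘(ℝ, E) x y))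
    (hF : DifferentiableAt ℝ F (extChartAt 𝓘(ℝ, E) x x)) (v : E) :
    mvfderiv 𝓘(ℝ, E) f x (v : TangentSpace 𝓘(ℝ, E) x) =
      fderiv ℝ F (extChartAt 𝓘(ℝ, E) x x) v := by
  have h1 : MDifferentiableAt 𝓘(ℝ, E) 𝓘(ℝ, ℝ) (fun y => F (extChartAt 𝓘(ℝ, E) x y)) x :=
    hF.mdifferentiableAt.comp x (mdifferentiableAt_extChartAt (mem_chart_source E x))
  have h2 : MDifferentiableAt 𝓘(ℝ, E) 𝓘(ℝ, ℝ) f x := h1.congr_of_eventuallyEq h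
  have h3 : mfderiv 𝓘(ℝ, E) 𝓘(ℝ, ℝ) f x =
      fderiv ℝ (writtenInExtChartAt 𝓘(ℝ, E) 𝓘(ℝ, ℝ) x f) (extChartAt 𝓘(ℝ, E) x x) := by
    rw [h2.mfderiv]
    simp [fderivWithin_univ]
    rfl
  change mfderiv 𝓘(ℝ, E) 𝓘(ℝ, ℝ) f x v = _
  rw [h3]
  have h4 : writtenInExtChartAt 𝓘(ℝ, E) 𝓘(ℝ, ℝ) x f =ᶠ[𝓝 (extChartAt 𝓘(ℝ, E) x x)] F := by
    have hc := (continuousAt_extChartAt_symm (I := 𝓘(ℝ, E)) x).eventually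
      (by rwa [extChartAt_to_inv] : ∀ᶠ y in 𝓝 ((extChartAt 𝓘(ℝ, E) x).symm
        (extChartAt 𝓘(ℝ, E) x x)), f y = F (extChartAt 𝓘(ℝ, E) x y))
    filter_upwards [hc, extChartAt_target_mem_nhds (I := 𝓘(ℝ, E)) x] with z hz hzt
    rw [(extChartAt 𝓘(ℝ, E) x).right_inv hzt] at hz
    exact hz
  rw [h4.fderiv_eq]
  rfl

/-- Tangent vectors are separated by the differentials of global smooth functions. -/
theorem eq_zero_of_mvfderiv_eq_zero {x : M} (v : TangentSpace 𝓘(ℝ, E) x)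
    (h : ∀ f : C^∞⟮𝓘(ℝ, E), M; ℝ⟯, mvfderiv 𝓘(ℝ, E) f x v = 0) : v = 0 := by
  obtain ⟨ψ⟩ : Nonempty (SmoothBumpFunction 𝓘(ℝ, E) x) := inferInstance
  refine (Module.finBasis ℝ E).ext_elem fun i => ?_
  let l : E →L[ℝ] ℝ := LinearMap.toContinuousLinearMap ((Module.finBasis ℝ E).coord i)
  have h1 := mvfderiv_eq_fderiv_of_eventuallyEq (bumpMul_eventuallyEq ψ l.contDiff)
    l.differentiableAt v
  rw [h, l.fderiv] at h1
  exact h1.symm.trans (map_zero l).symm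

section PointDerivation

variable {x : M} {δ : C^∞⟮𝓘(ℝ, E), M; ℝ⟯ →ₗ[ℝ] ℝ}

/-- Point derivations are local: if `f` vanishes near `x`, then `ψ * f = 0` for a bump function `ψ`
supported where `f` vanishes, and `ψ x = 1`. -/
theorem pointDerivation_eq_zero_of_eventuallyEq (hδ : ∀ f h, δ (f * h) = f x * δ h + h x * δ f)
    {f : C^∞⟮𝓘(ℝ, E), M; ℝ⟯} (hf : ∀ᶠ y in 𝓝 x, f y = 0) : δ f = 0 := by
  obtain ⟨ψ, -, hψ⟩ := (SmoothBumpFunction.nhds_basis_tsupport (I := 𝓘(ℝ, E)) x).mem_iff.1 hf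
  let a : C^∞⟮𝓘(ℝ, E), M; ℝ⟯ := ⟨ψ, ψ.contMDiff⟩
  have h0 : a * f = 0 := by
    ext y
    change ψ y * f y = 0
    by_cases hy : y ∈ tsupport ψ
    · rw [show f y = 0 from hψ hy, mul_zero]
    · rw [image_eq_zero_of_notMem_tsupport hy, zero_mul]
  have h1 := hδ a f
  have h2 : a x = 1 := ψ.eq_one
  rw [h0, map_zero, h2, hf.self_of_nhds] at h1
  linarith

theorem pointDerivation_congr (hδ : ∀ f h, δ (f * h) = f x * δ h + h x * δ f)
    {f h : C^∞⟮𝓘(ℝ, E), M; ℝ⟯} (hfh : ∀ᶠ y in 𝓝 x, f y = h y) : δ f = δ h := by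
  rw [← sub_eq_zero, ← map_sub]
  refine pointDerivation_eq_zero_of_eventuallyEq hδ ?_
  filter_upwards [hfh] with y hy
  rw [ContMDiffMap.coe_sub, Pi.sub_apply, hy, sub_self]

/-- Every derivation at `x` of the algebra of smooth functions is the directional derivative along
a tangent vector at `x`. -/
theorem exists_tangentVector (hδ : ∀ f h, δ (f * h) = f x * δ h + h x * δ f) :
    ∃ v : TangentSpace 𝓘(ℝ, E) x, ∀ f : C^∞⟮𝓘(ℝ, E), M; ℝ⟯, δ f = mvfderiv 𝓘(ℝ, E) f x v := by
  obtain ⟨ψ⟩ : Nonempty (SmoothBumpFunction 𝓘(ℝ, E) x) := inferInstance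
  set c := extChartAt 𝓘(ℝ, E) x x with hc
  let b := Module.finBasis ℝ E
  let l : Fin (Module.finrank ℝ E) → E →L[ℝ] ℝ := fun i =>
    LinearMap.toContinuousLinearMap (b.coord i)
  have hl : ∀ i, ContDiff ℝ ∞ fun z => l i (z - c) := fun i =>
    (l i).contDiff.comp (contDiff_id.sub contDiff_const)
  have h1 : δ 1 = 0 := by
    have h := hδ 1 1
    rw [mul_one, ContMDiffMap.coe_one, Pi.one_apply] at h
    linarith
  refine ⟨(∑ i, δ (bumpMul ψ (hl i)) • b i : E), fun f => ?_⟩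
  obtain ⟨F, hF, hfF⟩ := exists_contDiff_eventuallyEq f x
  obtain ⟨G, hG, hGc, hFG⟩ := exists_eq_add_apply_sub hF c
  have hGi : ∀ i, ContDiff ℝ ∞ fun z => G z (b i) := fun i => hG.clm_apply contDiff_const
  -- Hadamard's lemma writes `f` near `x` as a constant plus a sum of products, in which the first
  -- factors vanish at `x` and the second ones take the partial derivatives of `f` as values at `x`
  have h2 : ∀ᶠ y in 𝓝 x, f y =
      (F c • (1 : C^∞⟮𝓘(ℝ, E), M; ℝ⟯) + ∑ i, bumpMul ψ (hl i) * bumpMul ψ (hGi i)) y := by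
    have hα := Filter.eventually_all.2 fun i => bumpMul_eventuallyEq ψ (hl i)
    have hγ := Filter.eventually_all.2 fun i => bumpMul_eventuallyEq ψ (hGi i)
    filter_upwards [hfF, hα, hγ] with y hy hαy hγy
    have hs : (∑ i, bumpMul ψ (hl i) * bumpMul ψ (hGi i)) y =
        ∑ i, bumpMul ψ (hl i) y * bumpMul ψ (hGi i) y := by
      have := map_sum (ContMDiffMap.coeFnAlgHom (I := 𝓘(ℝ, E)) (N := M) (n := ∞) (A := ℝ)
        (𝕜 := ℝ)) (fun i => bumpMul ψ (hl i) * bumpMul ψ (hGi i)) Finset.univ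
      exact (congrFun this y).trans (Finset.sum_apply _ _ _)
    have hsum : G (extChartAt 𝓘(ℝ, E) x y) (extChartAt 𝓘(ℝ, E) x y - c) =
        ∑ i, l i (extChartAt 𝓘(ℝ, E) x y - c) * G (extChartAt 𝓘(ℝ, E) x y) (b i) := by
      conv_lhs => rw [← b.sum_repr (extChartAt 𝓘(ℝ, E) x y - c), map_sum]
      exact Finset.sum_congr rfl fun i _ => map_smul _ _ _
    rw [hy, hFG, hsum, ContMDiffMap.coe_add, Pi.add_apply, hs]
    simp only [hαy, hγy]
    congr 1
    change F c = F c • (1 : ℝ)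
    rw [smul_eq_mul, mul_one]
  rw [pointDerivation_congr hδ h2, map_add, map_smul, h1, smul_zero, zero_add, map_sum]
  rw [mvfderiv_eq_fderiv_of_eventuallyEq hfF (hF.differentiable (by simp) _), map_sum]
  refine Finset.sum_congr rfl fun i _ => ?_
  rw [hδ, bumpMul_self, bumpMul_self, ← hc, sub_self, map_zero, zero_mul, zero_add, map_smul, hGc,
    smul_eq_mul, mul_comm]

end PointDerivation

/-- A vector field is smooth as soon as it maps smooth functions to smooth functions: its
coordinates in a chart are the derivatives of the coordinate functions, cut off by a bump
function. -/
theorem contMDiff_vectorField_of_mvfderiv (X : ∀ x : M, TangentSpace 𝓘(ℝ, E) x)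
    (hX : ∀ f : C^∞⟮𝓘(ℝ, E), M; ℝ⟯,
      ContMDiff 𝓘(ℝ, E) 𝓘(ℝ, ℝ) ∞ fun x => mvfderiv 𝓘(ℝ, E) f x (X x)) :
    ContMDiff 𝓘(ℝ, E) 𝓘(ℝ, E).tangent ∞
      (fun x => (⟨x, X x⟩ : TangentBundle 𝓘(ℝ, E) M)) := by
  have hM1 : IsManifold 𝓘(ℝ, E) 1 M := IsManifold.of_le (n := ∞) (by simp)
  intro x₀
  obtain ⟨ψ⟩ : Nonempty (SmoothBumpFunction 𝓘(ℝ, E) x₀) := inferInstance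
  let b := Module.finBasis ℝ E
  let l : Fin (Module.finrank ℝ E) → E →L[ℝ] ℝ := fun i =>
    LinearMap.toContinuousLinearMap (b.coord i)
  refine (Bundle.contMDiffAt_section x₀).2 ?_
  have hsm : ContMDiffAt 𝓘(ℝ, E) 𝓘(ℝ, E) ∞ (fun x => ∑ i,
      mvfderiv 𝓘(ℝ, E) (bumpMul ψ (l i).contDiff) x (X x) • b i) x₀ :=
    ContMDiffAt.sum fun i _ => (hX _ x₀).smul contMDiffAt_const
  refine hsm.congr_of_eventuallyEq ?_
  have hev := Filter.eventually_all.2 fun i =>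
    (bumpMul_eventuallyEq ψ (l i).contDiff).eventually_nhds
  filter_upwards [hev, (chartAt E x₀).open_source.mem_nhds (mem_chart_source E x₀)] with x hx hxs
  have h1 : (trivializationAt E (TangentSpace 𝓘(ℝ, E) : M → Type _) x₀ ⟨x, X x⟩).2 =
      mfderiv 𝓘(ℝ, E) 𝓘(ℝ, E) (extChartAt 𝓘(ℝ, E) x₀) x (X x) := by
    have h2 := TangentBundle.continuousLinearMapAt_trivializationAt (I := 𝓘(ℝ, E)) hxs
    refine Eq.trans ?_ (congrArg (fun T : E →L[ℝ] E => T (X x)) h2)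
    have h3 : x ∈ (trivializationAt E (TangentSpace 𝓘(ℝ, E) : M → Type _) x₀).baseSet := by
      simpa using hxs
    exact (congrFun (Bundle.Trivialization.coe_linearMapAt_of_mem (R := ℝ) _ h3) (X x)).symm
  refine h1.trans ((b.sum_repr _).symm.trans ?_)
  refine Finset.sum_congr rfl fun i _ => ?_
  congr 1
  have h2 := mvfderiv_clm_comp (l i)
    (mdifferentiableAt_extChartAt (I := 𝓘(ℝ, E)) hxs) (X x)
  refine h2.symm.trans ?_
  have h3 : mfderiv 𝓘(ℝ, E) 𝓘(ℝ, ℝ) (bumpMul ψ (l i).contDiff) x =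
      mfderiv 𝓘(ℝ, E) 𝓘(ℝ, ℝ) (fun y => l i (extChartAt 𝓘(ℝ, E) x₀ y)) x :=
    Filter.EventuallyEq.mfderiv_eq (hx i)
  change mfderiv 𝓘(ℝ, E) 𝓘(ℝ, ℝ) (fun y => l i (extChartAt 𝓘(ℝ, E) x₀ y)) x (X x) =
    mfderiv 𝓘(ℝ, E) 𝓘(ℝ, ℝ) (bumpMul ψ (l i).contDiff) x (X x)
  rw [h3]
  rfl

/-- Every derivation of the algebra of smooth functions is given by a smooth vector field. -/
theorem exists_smoothVectorField
    (δ : C^∞⟮𝓘(ℝ, E), M; ℝ⟯ →ₗ[ℝ] C^∞⟮𝓘(ℝ, E), M; ℝ⟯)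
    (hδ : ∀ f h, δ (f * h) = f * δ h + h * δ f) :
    ∃ X : SmoothVectorField 𝓘(ℝ, E) M,
      ∀ (f : C^∞⟮𝓘(ℝ, E), M; ℝ⟯) (x : M), δ f x = mvfderiv 𝓘(ℝ, E) f x (X x) := by
  have hx : ∀ x : M, ∃ v : TangentSpace 𝓘(ℝ, E) x, ∀ f : C^∞⟮𝓘(ℝ, E), M; ℝ⟯,
      δ f x = mvfderiv 𝓘(ℝ, E) f x v := fun x =>
    exists_tangentVector
      (δ := { toFun := fun f => δ f x
              map_add' := fun f h => by rw [map_add]; rfl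
              map_smul' := fun c f => by rw [map_smul]; rfl })
      fun f h => by
        change δ (f * h) x = _
        rw [hδ]
        rfl
  choose X hX using hx
  refine ⟨⟨X, contMDiff_vectorField_of_mvfderiv X fun f => ?_⟩, fun f x => hX x f⟩
  exact (δ f).contMDiff.congr fun x => (hX x f).symm

end Derivations

/-! ### Derivations of the current algebra -/

section CurrentDerivations

variable {E : Type*} [NormedAddCommGroup E] [NormedSpace ℝ E] [FiniteDimensional ℝ E]
  {M : Type*} [TopologicalSpace M] [ChartedSpace E M] [IsManifold 𝓘(ℝ, E) ∞ M]
  {g : Type*} [LieRing g] [LieAlgebra ℝ g]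

instance : SMul C^∞⟮𝓘(ℝ, E), M; ℝ⟯ (CurrentAlgebra 𝓘(ℝ, E) M g) where
  smul a f := ⟨fun x => a x • f.1 x, fun l => by
    simp only [map_smul, smul_eq_mul]
    exact a.contMDiff.mul (f.2 l)⟩

theorem CurrentAlgebra.fun_smul_apply (a : C^∞⟮𝓘(ℝ, E), M; ℝ⟯)
    (f : CurrentAlgebra 𝓘(ℝ, E) M g) (x : M) : (a • f).1 x = a x • f.1 x := rfl

theorem CurrentAlgebra.ext_apply {f h : CurrentAlgebra 𝓘(ℝ, E) M g}
    (H : ∀ x, f.1 x = h.1 x) : f = h :=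
  Subtype.ext (funext H)

/-- `C^∞(M, g)` as a module over the algebra of smooth functions. -/
instance : Module C^∞⟮𝓘(ℝ, E), M; ℝ⟯ (CurrentAlgebra 𝓘(ℝ, E) M g) where
  one_smul _ := CurrentAlgebra.ext_apply fun _ => one_smul _ _
  mul_smul _ _ _ := CurrentAlgebra.ext_apply fun _ => mul_smul _ _ _
  smul_zero _ := CurrentAlgebra.ext_apply fun _ => smul_zero _
  smul_add _ _ _ := CurrentAlgebra.ext_apply fun _ => smul_add _ _ _
  add_smul _ _ _ := CurrentAlgebra.ext_apply fun _ => add_smul _ _ _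
  zero_smul _ := CurrentAlgebra.ext_apply fun _ => zero_smul _ _

variable (E M) in
/-- The constant map with value `v`. -/
def constCurrent : g →ₗ[ℝ] CurrentAlgebra 𝓘(ℝ, E) M g where
  toFun v := ⟨fun _ => v, fun _ => contMDiff_const⟩
  map_add' _ _ := rfl
  map_smul' _ _ := rfl

theorem constCurrent_apply (v : g) (x : M) : (constCurrent E M v).1 x = v := rfl

theorem CurrentAlgebra.smul_real (c : ℝ) (a : C^∞⟮𝓘(ℝ, E), M; ℝ⟯)
    (f : CurrentAlgebra 𝓘(ℝ, E) M g) : (c • a) • f = c • a • f :=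
  CurrentAlgebra.ext_apply fun x => smul_assoc c (a x) (f.1 x)

theorem CurrentAlgebra.smul_comm_real (c : ℝ) (a : C^∞⟮𝓘(ℝ, E), M; ℝ⟯)
    (f : CurrentAlgebra 𝓘(ℝ, E) M g) : a • c • f = c • a • f :=
  CurrentAlgebra.ext_apply fun x => smul_comm (a x) c (f.1 x)

/-- The composite of a smooth map with a linear functional. -/
def CurrentAlgebra.coordFun (l : g →ₗ[ℝ] ℝ) (f : CurrentAlgebra 𝓘(ℝ, E) M g) :
    C^∞⟮𝓘(ℝ, E), M; ℝ⟯ :=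
  ⟨fun x => l (f.1 x), f.2 l⟩

variable [FiniteDimensional ℝ g]

theorem constCurrent_lie (u v : g) :
    constCurrent E M ⁅u, v⁆ = ⁅constCurrent E M u, constCurrent E M v⁆ := rfl

theorem CurrentAlgebra.fun_smul_lie (a : C^∞⟮𝓘(ℝ, E), M; ℝ⟯)
    (f h : CurrentAlgebra 𝓘(ℝ, E) M g) : ⁅a • f, h⁆ = a • ⁅f, h⁆ :=
  CurrentAlgebra.ext_apply fun _ => smul_lie _ _ _

theorem CurrentAlgebra.lie_fun_smul (a : C^∞⟮𝓘(ℝ, E), M; ℝ⟯)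
    (f h : CurrentAlgebra 𝓘(ℝ, E) M g) : ⁅f, a • h⁆ = a • ⁅f, h⁆ :=
  CurrentAlgebra.ext_apply fun _ => lie_smul _ _ _

theorem CurrentAlgebra.eq_sum_smul_constCurrent (f : CurrentAlgebra 𝓘(ℝ, E) M g) :
    f = ∑ i, f.coordFun ((Module.finBasis ℝ g).coord i) •
      constCurrent E M (Module.finBasis ℝ g i) := by
  refine CurrentAlgebra.ext_apply fun x => ?_
  rw [Submodule.coe_sum, Finset.sum_apply]
  exact ((Module.finBasis ℝ g).sum_repr (f.1 x)).symm

/-- A map which is linear over the smooth functions acts pointwise. -/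
theorem apply_eq_apply_constCurrent
    (T : CurrentAlgebra 𝓘(ℝ, E) M g →ₗ[ℝ] CurrentAlgebra 𝓘(ℝ, E) M g)
    (hT : ∀ (a : C^∞⟮𝓘(ℝ, E), M; ℝ⟯) (v : g),
      T (a • constCurrent E M v) = a • T (constCurrent E M v))
    (f : CurrentAlgebra 𝓘(ℝ, E) M g) (x : M) :
    (T f).1 x = (T (constCurrent E M (f.1 x))).1 x := by
  conv_lhs => rw [CurrentAlgebra.eq_sum_smul_constCurrent f]
  conv_rhs => rw [← (Module.finBasis ℝ g).sum_repr (f.1 x)]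
  simp only [map_sum, hT, map_smul, Submodule.coe_sum, Finset.sum_apply]
  rfl

/-- An operator commuting with the adjoint representation is linear over the smooth functions,
since `g` is perfect: `T (a [u, v]) = [a u, T v] = a T [u, v]`. -/
theorem centroid_fun_smul (hg : LieAlgebra.IsSimple ℝ g)
    (T : CurrentAlgebra 𝓘(ℝ, E) M g →ₗ[ℝ] CurrentAlgebra 𝓘(ℝ, E) M g)
    (hT : ∀ f h : CurrentAlgebra 𝓘(ℝ, E) M g, T ⁅f, h⁆ = ⁅f, T h⁆)
    (a : C^∞⟮𝓘(ℝ, E), M; ℝ⟯) (w : g) :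
    T (a • constCurrent E M w) = a • T (constCurrent E M w) := by
  have hw : w ∈ Submodule.span ℝ {w : g | ∃ u v : g, ⁅u, v⁆ = w} := by
    rw [span_commutators_eq_top hg]
    trivial
  induction hw using Submodule.span_induction with
  | mem w h =>
    obtain ⟨u, v, rfl⟩ := h
    rw [constCurrent_lie, ← CurrentAlgebra.fun_smul_lie, hT, hT, CurrentAlgebra.fun_smul_lie]
  | zero => rw [map_zero, smul_zero, map_zero, smul_zero]
  | add v w _ _ hv hw => rw [map_add, smul_add, map_add, hv, hw, map_add, smul_add]
  | smul c w _ hw =>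
    rw [map_smul (constCurrent E M), CurrentAlgebra.smul_comm_real, map_smul T c, hw, map_smul T c,
      CurrentAlgebra.smul_comm_real]

theorem exists_apply_eq_one_of_isSimple (hg : LieAlgebra.IsSimple ℝ g) :
    ∃ (v : g) (l : g →ₗ[ℝ] ℝ), l v = 1 := by
  have hnt : Nontrivial g := by
    by_contra hn
    rw [not_nontrivial_iff_subsingleton] at hn
    exact hg.non_abelian ⟨fun _ _ => Subsingleton.elim _ _⟩
  obtain ⟨v, hv⟩ := exists_ne (0 : g)
  obtain ⟨l, hl⟩ := Module.Projective.exists_dual_ne_zero ℝ hv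
  exact ⟨v, (l v)⁻¹ • l, by simp [hl]⟩

/-- The centroid of `C^∞(M, g)` is the algebra of smooth functions. -/
theorem exists_eq_fun_smul (hg : LieAlgebra.IsSimple ℝ g)
    (hgC : LieAlgebra.IsSimple ℂ (ℂ ⊗[ℝ] g))
    (T : CurrentAlgebra 𝓘(ℝ, E) M g →ₗ[ℝ] CurrentAlgebra 𝓘(ℝ, E) M g)
    (hT : ∀ f h : CurrentAlgebra 𝓘(ℝ, E) M g, T ⁅f, h⁆ = ⁅f, T h⁆) :
    ∃ c : C^∞⟮𝓘(ℝ, E), M; ℝ⟯, ∀ f, T f = c • f := by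
  have hx : ∀ x : M, ∃ c : ℝ, ∀ v : g, (T (constCurrent E M v)).1 x = c • v := fun x =>
    exists_eq_smul_of_lie_comm hgC
      { toFun := fun v => (T (constCurrent E M v)).1 x
        map_add' := fun u v => by rw [map_add, map_add]; rfl
        map_smul' := fun c v => by rw [map_smul, map_smul]; rfl }
      fun u v => by
        change (T (constCurrent E M ⁅u, v⁆)).1 x = ⁅u, (T (constCurrent E M v)).1 x⁆
        rw [constCurrent_lie, hT]
        rfl
  choose c hc using hx
  obtain ⟨v, l, hl⟩ := exists_apply_eq_one_of_isSimple hg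
  refine ⟨⟨c, ?_⟩, fun f => CurrentAlgebra.ext_apply fun x => ?_⟩
  · refine ((T (constCurrent E M v)).2 l).congr fun x => ?_
    rw [hc, map_smul, hl, smul_eq_mul, mul_one]
  · rw [apply_eq_apply_constCurrent T (centroid_fun_smul hg T hT), hc]
    rfl

theorem fun_smul_left_injective (hg : LieAlgebra.IsSimple ℝ g) {a b : C^∞⟮𝓘(ℝ, E), M; ℝ⟯}
    (h : ∀ f : CurrentAlgebra 𝓘(ℝ, E) M g, a • f = b • f) : a = b := by
  obtain ⟨v, l, hl⟩ := exists_apply_eq_one_of_isSimple hg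
  ext x
  have h1 := congrArg (fun f : CurrentAlgebra 𝓘(ℝ, E) M g => l (f.1 x)) (h (constCurrent E M v))
  simpa [CurrentAlgebra.fun_smul_apply, constCurrent_apply, hl] using h1

/-- A derivation `D` of `C^∞(M, g)` induces a derivation of the smooth functions: the commutator
of `D` with the multiplication by `a` lies in the centroid. -/
theorem exists_derivation_fun (hg : LieAlgebra.IsSimple ℝ g)
    (hgC : LieAlgebra.IsSimple ℂ (ℂ ⊗[ℝ] g))
    (D : LieDerivation ℝ (CurrentAlgebra 𝓘(ℝ, E) M g) (CurrentAlgebra 𝓘(ℝ, E) M g)) :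
    ∃ δ : C^∞⟮𝓘(ℝ, E), M; ℝ⟯ →ₗ[ℝ] C^∞⟮𝓘(ℝ, E), M; ℝ⟯,
      (∀ a b, δ (a * b) = a * δ b + b * δ a) ∧
      ∀ (a : C^∞⟮𝓘(ℝ, E), M; ℝ⟯) (f : CurrentAlgebra 𝓘(ℝ, E) M g),
        D (a • f) = a • D f + δ a • f := by
  have ha : ∀ a : C^∞⟮𝓘(ℝ, E), M; ℝ⟯, ∃ c : C^∞⟮𝓘(ℝ, E), M; ℝ⟯,
      ∀ f : CurrentAlgebra 𝓘(ℝ, E) M g, D (a • f) - a • D f = c • f := by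
    intro a
    refine exists_eq_fun_smul hg hgC
      { toFun := fun f => D (a • f) - a • D f
        map_add' := fun f h => by rw [smul_add, map_add, map_add, smul_add]; abel
        map_smul' := fun c f => by
          rw [CurrentAlgebra.smul_comm_real, map_smul D c, map_smul D c, CurrentAlgebra.smul_comm_real,
            RingHom.id_apply, smul_sub] } fun f h => ?_
    change D (a • ⁅f, h⁆) - a • D ⁅f, h⁆ = ⁅f, D (a • h) - a • D h⁆
    rw [← CurrentAlgebra.lie_fun_smul, LieDerivation.apply_lie_eq_add,
      LieDerivation.apply_lie_eq_add, smul_add, CurrentAlgebra.lie_fun_smul, lie_sub,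
      CurrentAlgebra.lie_fun_smul]
    abel
  choose c hc using ha
  have hc' : ∀ a (f : CurrentAlgebra 𝓘(ℝ, E) M g), D (a • f) = a • D f + c a • f := fun a f => by
    rw [← hc]
    abel
  -- the properties of `c` follow from its uniqueness
  refine ⟨{ toFun := c, map_add' := fun a b => ?_, map_smul' := fun t a => ?_ },
    fun a b => ?_, hc'⟩
  · refine fun_smul_left_injective (g := g) hg fun f => ?_
    rw [add_smul, ← hc, ← hc, ← hc, add_smul, add_smul, map_add]
    abel
  · refine fun_smul_left_injective (g := g) hg fun f => ?_
    rw [RingHom.id_apply, CurrentAlgebra.smul_real, ← hc, ← hc, CurrentAlgebra.smul_real,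
      CurrentAlgebra.smul_real, map_smul, smul_sub]
  · refine fun_smul_left_injective (g := g) hg fun f => ?_
    change c (a * b) • f = (a * c b + b * c a) • f
    rw [← hc, mul_smul, hc', hc', add_smul, mul_smul, mul_smul, mul_smul, smul_add,
      ← mul_smul (c a) b, ← mul_smul b (c a), mul_comm (c a) b]
    abel

theorem vectorFieldAction_fun_smul (X : SmoothVectorField 𝓘(ℝ, E) M)
    (a : C^∞⟮𝓘(ℝ, E), M; ℝ⟯) (f : CurrentAlgebra 𝓘(ℝ, E) M g) (x : M) :
    (vectorFieldAction 𝓘(ℝ, E) M g X (a • f)).1 x =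
      a x • (vectorFieldAction 𝓘(ℝ, E) M g X f).1 x +
        mvfderiv 𝓘(ℝ, E) a x (X x) • f.1 x := by
  refine (Module.finBasis ℝ g).ext_elem fun i => ?_
  change (Module.finBasis ℝ g).coord i _ = (Module.finBasis ℝ g).coord i _
  set l := (Module.finBasis ℝ g).coord i
  rw [map_add, map_smul l, map_smul l, vectorFieldAction_apply, vectorFieldAction_apply,
    apply_dirDeriv _ f.2, apply_dirDeriv _ (a • f).2]
  have h1 : (fun y => l ((a • f).1 y)) = a * fun y => l (f.1 y) :=
    funext fun y => map_smul l (a y) (f.1 y)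
  have h2 := mvfderiv_mul (a.contMDiff.mdifferentiable (by simp) x)
    ((f.2 l).mdifferentiable (by simp) x)
  have h3 := congrArg (fun L => L (X x)) h2
  rw [h1]
  refine h3.trans ?_
  simp only [_root_.add_apply, _root_.smul_apply, smul_eq_mul]
  ring

/-- A derivation which is linear over the smooth functions is inner. -/
theorem exists_eq_lie_of_fun_linear (hg : LieAlgebra.IsSimple ℝ g)
    (D : LieDerivation ℝ (CurrentAlgebra 𝓘(ℝ, E) M g) (CurrentAlgebra 𝓘(ℝ, E) M g))
    (hD : ∀ (a : C^∞⟮𝓘(ℝ, E), M; ℝ⟯) (f : CurrentAlgebra 𝓘(ℝ, E) M g), D (a • f) = a • D f) :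
    ∃ f : CurrentAlgebra 𝓘(ℝ, E) M g, ∀ h, D h = ⁅f, h⁆ := by
  have hx : ∀ x : M, ∃ u : g, ∀ v, (D (constCurrent E M v)).1 x = ⁅u, v⁆ := fun x =>
    exists_forall_lie_eq hg
      { toFun := fun v => (D (constCurrent E M v)).1 x
        map_add' := fun u v => by rw [map_add, map_add]; rfl
        map_smul' := fun c v => by rw [map_smul, map_smul]; rfl
        leibniz' := fun u v => by
          change (D (constCurrent E M ⁅u, v⁆)).1 x = ⁅u, (D (constCurrent E M v)).1 x⁆ -
            ⁅v, (D (constCurrent E M u)).1 x⁆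
          rw [constCurrent_lie, LieDerivation.apply_lie_eq_sub]
          rfl }
  choose u hu using hx
  let b := Module.finBasis ℝ g
  -- `w` is recovered from the brackets `[w, bᵢ]` by a linear map, hence smoothly
  let J : g →ₗ[ℝ] (Fin (Module.finrank ℝ g) → g) :=
    LinearMap.pi fun i => -(LieAlgebra.ad ℝ g (b i) : g →ₗ[ℝ] g)
  have hJ : ∀ w i, J w i = ⁅w, b i⁆ := fun w i => by
    change -⁅b i, w⁆ = ⁅w, b i⁆
    rw [lie_skew]
  have hJinj : LinearMap.ker J = ⊥ := by
    refine LinearMap.ker_eq_bot'.2 fun w hw => eq_zero_of_forall_lie_eq_zero hg fun v => ?_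
    rw [← b.sum_repr v, lie_sum]
    refine Finset.sum_eq_zero fun i _ => ?_
    rw [lie_smul, ← hJ, hw, Pi.zero_apply, smul_zero]
  obtain ⟨R, hR⟩ := J.exists_leftInverse_of_injective hJinj
  have huR : ∀ x, u x = ∑ i, R (Pi.single i ((D (constCurrent E M (b i))).1 x)) := by
    intro x
    have h1 : R (J (u x)) = u x := LinearMap.congr_fun hR (u x)
    rw [← map_sum, Finset.univ_sum_single, ← h1]
    congr 1
    funext i
    rw [hJ, hu]
  refine ⟨⟨u, fun l => ?_⟩, fun h => CurrentAlgebra.ext_apply fun x => ?_⟩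
  · simp only [huR, map_sum]
    exact ContMDiff.sum fun i _ =>
      (D (constCurrent E M (b i))).2 (l ∘ₗ R ∘ₗ LinearMap.single ℝ (fun _ => g) i)
  · have h1 := apply_eq_apply_constCurrent (D : CurrentAlgebra 𝓘(ℝ, E) M g →ₗ[ℝ] _)
      (fun a v => hD a _) h x
    exact h1.trans (hu x (h.1 x))

/-- Every derivation of `C^∞(M, g)` is uniquely the sum of an inner derivation and the derivation
given by a vector field. -/
theorem bijective_ad_add_vectorFieldAction [T2Space M] (hg : LieAlgebra.IsSimple ℝ g)
    (hgC : LieAlgebra.IsSimple ℂ (ℂ ⊗[ℝ] g)) :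
    Function.Bijective fun q : CurrentAlgebra 𝓘(ℝ, E) M g × SmoothVectorField 𝓘(ℝ, E) M =>
      LieDerivation.ad ℝ (CurrentAlgebra 𝓘(ℝ, E) M g) q.1 +
        vectorFieldAction 𝓘(ℝ, E) M g q.2 := by
  constructor
  · suffices H : ∀ (f : CurrentAlgebra 𝓘(ℝ, E) M g) (X : SmoothVectorField 𝓘(ℝ, E) M),
        LieDerivation.ad ℝ _ f + vectorFieldAction 𝓘(ℝ, E) M g X = 0 → f = 0 ∧ X = 0 by
      rintro ⟨f, X⟩ ⟨f', X'⟩ h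
      have h' : LieDerivation.ad ℝ _ f + vectorFieldAction 𝓘(ℝ, E) M g X =
        LieDerivation.ad ℝ _ f' + vectorFieldAction 𝓘(ℝ, E) M g X' := h
      obtain ⟨h1, h2⟩ := H (f - f') (X - X') (by
        rw [map_sub, map_sub, sub_add_sub_comm, h', sub_self])
      exact Prod.ext (sub_eq_zero.1 h1) (sub_eq_zero.1 h2)
    intro f X h
    have hh : ∀ (h : CurrentAlgebra 𝓘(ℝ, E) M g) (x : M),
        ⁅f.1 x, h.1 x⁆ + (vectorFieldAction 𝓘(ℝ, E) M g X h).1 x = 0 := fun k x => by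
      have h1 := congrArg (fun T : LieDerivation ℝ _ _ => (T k).1 x) h
      simp only [LieDerivation.add_apply, LieDerivation.ad_apply_apply] at h1
      exact h1
    -- vector fields kill constants, so testing on constants isolates `f`
    have hc : ∀ (v : g) (x : M),
        (vectorFieldAction 𝓘(ℝ, E) M g X (constCurrent E M v)).1 x = 0 := by
      intro v x
      refine (Module.finBasis ℝ g).ext_elem fun i => ?_
      change (Module.finBasis ℝ g).coord i _ = (Module.finBasis ℝ g).coord i _
      rw [vectorFieldAction_apply, apply_dirDeriv _ (constCurrent E M v).2, map_zero]
      change mvfderiv 𝓘(ℝ, E) (fun _ : M => (Module.finBasis ℝ g).coord i v) x (X x) = 0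
      rw [mvfderiv_const]
      rfl
    have hf : f = 0 := CurrentAlgebra.ext_apply fun x => by
      refine eq_zero_of_forall_lie_eq_zero hg fun v => ?_
      have h1 := hh (constCurrent E M v) x
      rwa [hc, add_zero] at h1
    refine ⟨hf, ?_⟩
    obtain ⟨v, l, hl⟩ := exists_apply_eq_one_of_isSimple hg
    ext x
    refine eq_zero_of_mvfderiv_eq_zero _ fun a => ?_
    have h1 := hh (a • constCurrent E M v) x
    rw [vectorFieldAction_fun_smul, hc, hf, smul_zero, zero_add, constCurrent_apply] at h1
    have h2 := congrArg l h1
    simpa [hl] using h2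
  · intro D
    obtain ⟨δ, hδ, hD⟩ := exists_derivation_fun hg hgC D
    obtain ⟨X, hX⟩ := exists_smoothVectorField δ hδ
    obtain ⟨f, hf⟩ := exists_eq_lie_of_fun_linear hg (D - vectorFieldAction 𝓘(ℝ, E) M g X)
      fun a f => by
        refine CurrentAlgebra.ext_apply fun x => ?_
        change (D (a • f)).1 x - (vectorFieldAction 𝓘(ℝ, E) M g X (a • f)).1 x =
          a x • ((D f).1 x - (vectorFieldAction 𝓘(ℝ, E) M g X f).1 x)
        rw [vectorFieldAction_fun_smul, hD, ← hX, smul_sub]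
        change a x • (D f).1 x + δ a x • f.1 x - _ = _
        abel
    refine ⟨(f, X), LieDerivation.ext fun h => ?_⟩
    change LieDerivation.ad ℝ _ f h + vectorFieldAction 𝓘(ℝ, E) M g X h = D h
    rw [LieDerivation.ad_apply_apply, ← hf]
    exact sub_add_cancel _ _

end CurrentDerivations

/-! ### Extensions of Lie algebras with known derivations -/

section Extensions

variable {K V k L : Type*} [LieRing K] [LieAlgebra ℝ K] [LieRing V] [LieAlgebra ℝ V]
  [LieRing k] [LieAlgebra ℝ k] [LieRing L] [LieAlgebra ℝ L]

/-- The homomorphism `K ⋊ V → der K`, `(f, X) ↦ ad f + ρ X`. -/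
def semiDirectToDerivation (ρ : V →ₗ⁅ℝ⁆ LieDerivation ℝ K K) :
    LieAlgebra.SemiDirectSum K V ρ →ₗ⁅ℝ⁆ LieDerivation ℝ K K where
  toFun q := LieDerivation.ad ℝ K q.left + ρ q.right
  map_add' q q' := by
    change LieDerivation.ad ℝ K (q.left + q'.left) + ρ (q.right + q'.right) = _
    rw [map_add, map_add]
    abel
  map_smul' c q := by
    change LieDerivation.ad ℝ K (c • q.left) + ρ (c • q.right) = _
    rw [map_smul, map_smul, RingHom.id_apply, smul_add]
  map_lie' {q q'} := by
    change LieDerivation.ad ℝ K (⁅q.left, q'.left⁆ + ρ q.right q'.left - ρ q'.right q.left) +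
      ρ ⁅q.right, q'.right⁆ = _
    rw [map_sub, map_add, LieHom.map_lie, LieHom.map_lie, add_lie, lie_add, lie_add,
      ← lie_skew (LieDerivation.ad ℝ K q.left) (ρ q'.right), LieDerivation.lie_der_ad_eq_ad_der,
      LieDerivation.lie_der_ad_eq_ad_der, LieDerivation.lie_der_ad_eq_ad_der,
      LieDerivation.ad_apply_apply]
    abel

variable {i : K →ₗ⁅ℝ⁆ L} {p : L →ₗ⁅ℝ⁆ k}

theorem extension_injective (hext : LieAlgebra.IsExtension i p) : Function.Injective i :=
  (LieHom.ker_eq_bot i).1 hext.ker_eq_bot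

theorem extension_surjective (hext : LieAlgebra.IsExtension i p) : Function.Surjective p :=
  (LieHom.range_eq_top p).1 hext.range_eq_top

theorem extension_exact (hext : LieAlgebra.IsExtension i p) : Function.Exact i p :=
  (LieHom.range_eq_ker_iff i p).1 hext.exact

/-- The action of the total algebra of an extension on its kernel. -/
theorem exists_extension_derivation (hext : LieAlgebra.IsExtension i p) :
    ∃ δ : L →ₗ⁅ℝ⁆ LieDerivation ℝ K K, ∀ l f, i (δ l f) = ⁅l, i f⁆ := by
  have hinj := extension_injective hext
  have hex : ∀ (l : L) (f : K), ∃ h : K, i h = ⁅l, i f⁆ := fun l f => by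
    refine (extension_exact hext _).1 ?_
    rw [LieHom.map_lie, (extension_exact hext).apply_apply_eq_zero, lie_zero]
  choose d hd using hex
  refine ⟨{ toFun := fun l =>
              { toFun := d l
                map_add' := fun f h => hinj (by rw [map_add, hd, hd, hd, map_add, lie_add])
                map_smul' := fun c f => hinj (by
                  rw [map_smul, hd, hd, map_smul, lie_smul, RingHom.id_apply])
                leibniz' := fun f h => hinj ?_ }
            map_add' := fun l m => LieDerivation.ext fun f => hinj ?_
            map_smul' := fun c l => LieDerivation.ext fun f => hinj ?_
            map_lie' := fun {l m} => LieDerivation.ext fun f => hinj ?_ }, hd⟩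
  · change i (d l ⁅f, h⁆) = i (⁅f, d l h⁆ - ⁅h, d l f⁆)
    rw [map_sub, LieHom.map_lie, LieHom.map_lie, hd, hd, hd, LieHom.map_lie, leibniz_lie,
      ← lie_skew ⁅l, i f⁆ (i h)]
    abel
  · change i (d (l + m) f) = i (d l f + d m f)
    rw [map_add, hd, hd, hd, add_lie]
  · change i (d (c • l) f) = i (c • d l f)
    rw [map_smul, hd, hd, smul_lie]
  · rw [LieDerivation.commutator_apply]
    change i (d ⁅l, m⁆ f) = i (d l (d m f) - d m (d l f))
    rw [map_sub, hd, hd, hd, hd, hd, lie_lie]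

/-- If every derivation of `K` is uniquely of the form `ad f + ρ X`, then every extension by `K` is
a semidirect sum: the total algebra acts on `K` by `l ↦ ad (f l) + ρ (X l)`, the map `X` factors
through the quotient `k`, and `l ↦ (f l, p l)` is an isomorphism. -/
theorem exists_semiDirectSum_equiv (ρ : V →ₗ⁅ℝ⁆ LieDerivation ℝ K K)
    (hρ : Function.Bijective fun q : K × V => LieDerivation.ad ℝ K q.1 + ρ q.2)
    (hext : LieAlgebra.IsExtension i p) :
    ∃ (r : k →ₗ⁅ℝ⁆ V) (Φ : LieAlgebra.SemiDirectSum K k (ρ.comp r) ≃ₗ⁅ℝ⁆ L),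
      (∀ f, Φ (LieAlgebra.SemiDirectSum.inl _ f) = i f) ∧
      (∀ z, p (Φ z) = LieAlgebra.SemiDirectSum.projr _ z) := by
  have hΘ : Function.Bijective (semiDirectToDerivation ρ) :=
    hρ.comp (LieAlgebra.SemiDirectSum.toProd (ψ := ρ)).bijective
  let Θ := LieEquiv.ofBijective _ hΘ
  obtain ⟨δ, hδ⟩ := exists_extension_derivation hext
  let β : L →ₗ⁅ℝ⁆ LieAlgebra.SemiDirectSum K V ρ := Θ.symm.toLieHom.comp δ
  have hβi : ∀ f, β (i f) = LieAlgebra.SemiDirectSum.inl ρ f := by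
    intro f
    refine Θ.injective ((Θ.apply_symm_apply _).trans ?_)
    refine LieDerivation.ext fun h => extension_injective hext ?_
    refine (hδ (i f) h).trans ?_
    rw [← LieHom.map_lie]
    change i ⁅f, h⁆ = i ((LieDerivation.ad ℝ K f + ρ 0) h)
    rw [map_zero, add_zero, LieDerivation.ad_apply_apply]
  -- the vector field component of the action of `l` depends only on `p l`
  have hright : ∀ l m, p l = p m → (β l).right = (β m).right := by
    intro l m hlm
    obtain ⟨f, hf⟩ := (extension_exact hext (l - m)).1 (by rw [map_sub, hlm, sub_self])
    have h1 : (β (l - m)).right = 0 := by rw [← hf, hβi]; rfl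
    rw [map_sub] at h1
    exact sub_eq_zero.1 h1
  choose s hs using extension_surjective hext
  let r : k →ₗ⁅ℝ⁆ V :=
    { toFun := fun z => (β (s z)).right
      map_add' := fun z w => by
        rw [hright (s (z + w)) (s z + s w) (by rw [map_add, hs, hs, hs]), map_add]
        rfl
      map_smul' := fun c z => by
        rw [hright (s (c • z)) (c • s z) (by rw [map_smul, hs, hs]), map_smul]
        rfl
      map_lie' := fun {z w} => by
        rw [hright (s ⁅z, w⁆) ⁅s z, s w⁆ (by rw [LieHom.map_lie, hs, hs, hs]), LieHom.map_lie]
        rfl }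
  have hr : ∀ l, r (p l) = (β l).right := fun l => hright _ _ (hs (p l))
  let Ψ : L →ₗ⁅ℝ⁆ LieAlgebra.SemiDirectSum K k (ρ.comp r) :=
    { toFun := fun l => ⟨(β l).left, p l⟩
      map_add' := fun l m => by
        rw [map_add, map_add]
        rfl
      map_smul' := fun c l => by
        rw [map_smul, map_smul]
        rfl
      map_lie' := fun {l m} => by
        rw [LieHom.map_lie, LieHom.map_lie, LieAlgebra.SemiDirectSum.lie_eq_mk,
          LieAlgebra.SemiDirectSum.lie_eq_mk]
        simp only [LieHom.comp_apply, hr] }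
  have hΨi : ∀ f, Ψ (i f) = LieAlgebra.SemiDirectSum.inl _ f := by
    intro f
    change (⟨(β (i f)).left, p (i f)⟩ : LieAlgebra.SemiDirectSum K k (ρ.comp r)) = ⟨f, 0⟩
    rw [hβi, (extension_exact hext).apply_apply_eq_zero]
    rfl
  have hΨ : Function.Bijective Ψ := by
    constructor
    · rw [injective_iff_map_eq_zero]
      intro l hl
      have h1 : p l = 0 := congrArg LieAlgebra.SemiDirectSum.right hl
      obtain ⟨f, rfl⟩ := (extension_exact hext l).1 h1
      rw [hΨi] at hl
      have h2 : f = 0 := congrArg LieAlgebra.SemiDirectSum.left hl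
      rw [h2, map_zero]
    · rintro ⟨f, z⟩
      refine ⟨s z + i (f - (β (s z)).left), ?_⟩
      rw [map_add, hΨi]
      change (⟨(β (s z)).left + (f - (β (s z)).left), p (s z) + 0⟩ :
        LieAlgebra.SemiDirectSum K k (ρ.comp r)) = ⟨f, z⟩
      rw [hs, add_zero, add_sub_cancel]
  let Φ := (LieEquiv.ofBijective Ψ hΨ).symm
  refine ⟨r, Φ, fun f => ?_, fun z => ?_⟩
  · exact (LieEquiv.ofBijective Ψ hΨ).injective
      (((LieEquiv.ofBijective Ψ hΨ).apply_symm_apply _).trans (hΨi f).symm)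
  · have h := (LieEquiv.ofBijective Ψ hΨ).apply_symm_apply z
    exact congrArg LieAlgebra.SemiDirectSum.right h

/-- A splitting of an extension of topological Lie algebras with finite-dimensional quotient is
automatically a homeomorphism: linear maps out of `k` are continuous. -/
theorem isHomeomorph_of_splitting [FiniteDimensional ℝ k] {ψ : k →ₗ⁅ℝ⁆ LieDerivation ℝ K K}
    (Φ : LieAlgebra.SemiDirectSum K k ψ ≃ₗ⁅ℝ⁆ L)
    (hΦi : ∀ f, Φ (LieAlgebra.SemiDirectSum.inl _ f) = i f)
    (hΦp : ∀ z, p (Φ z) = LieAlgebra.SemiDirectSum.projr _ z)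
    [TopologicalSpace K] [TopologicalSpace k] [IsTopologicalAddGroup k] [ContinuousSMul ℝ k]
    [T2Space k] [TopologicalSpace L] [IsTopologicalAddGroup L] [ContinuousSMul ℝ L]
    (hi : Topology.IsEmbedding i) (hp : Continuous p) :
    IsHomeomorph (fun q : K × k => Φ (LieAlgebra.SemiDirectSum.toProd.symm q)) := by
  let σ : k →ₗ[ℝ] L := Φ.toLieHom.toLinearMap ∘ₗ (LieAlgebra.SemiDirectSum.inr ψ).toLinearMap
  have hσ : Continuous σ := σ.continuous_of_finiteDimensional
  have hΦ : ∀ q : K × k, Φ (LieAlgebra.SemiDirectSum.toProd.symm q) = i q.1 + σ q.2 := by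
    rintro ⟨f, z⟩
    rw [← hΦi]
    change Φ ⟨f, z⟩ = Φ ⟨f, 0⟩ + Φ ⟨0, z⟩
    rw [← map_add, LieAlgebra.SemiDirectSum.add_eq_mk, add_zero, zero_add]
  let e : K × k ≃ L := LieAlgebra.SemiDirectSum.toProd.symm.trans Φ.toLinearEquiv.toEquiv
  have he : ∀ q, e q = i q.1 + σ q.2 := hΦ
  have hpe : ∀ l, p l = (e.symm l).2 := fun l => by
    conv_lhs => rw [← e.apply_symm_apply l]
    exact hΦp _
  have hsnd : Continuous fun l => (e.symm l).2 := by
    simpa only [← hpe] using hp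
  have hfst : Continuous fun l => (e.symm l).1 := by
    rw [hi.continuous_iff]
    have h1 : (i ∘ fun l => (e.symm l).1) = fun l => l - σ (e.symm l).2 := funext fun l => by
      rw [eq_sub_iff_add_eq, Function.comp_apply, ← he, e.apply_symm_apply]
    rw [h1]
    exact continuous_id.sub (hσ.comp hsnd)
  have hcont : Continuous e := by
    rw [show (e : K × k → L) = fun q => i q.1 + σ q.2 from funext he]
    exact (hi.continuous.comp continuous_fst).add (hσ.comp continuous_snd)
  exact (Homeomorph.mk e hcont (hfst.prodMk hsnd)).isHomeomorph

end Extensions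

end CurrentExt
end

theorem mainTheorem8
    {E : Type*} [NormedAddCommGroup E] [NormedSpace ℝ E] [FiniteDimensional ℝ E]
    {M : Type*} [TopologicalSpace M] [ChartedSpace E M] [IsManifold 𝓘(ℝ, E) ∞ M]
    [T2Space M] [CompactSpace M]
    {g : Type*} [LieRing g] [LieAlgebra ℝ g] [FiniteDimensional ℝ g]
    (hg : LieAlgebra.IsSimple ℝ g) (hgC : LieAlgebra.IsSimple ℂ (ℂ ⊗[ℝ] g))
    {k : Type*} [LieRing k] [LieAlgebra ℝ k] [FiniteDimensional ℝ k]
    {L : Type*} [LieRing L] [LieAlgebra ℝ L]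
    (i : CurrentExt.CurrentAlgebra 𝓘(ℝ, E) M g →ₗ⁅ℝ⁆ L) (p : L →ₗ⁅ℝ⁆ k)
    (hext : LieAlgebra.IsExtension i p) :
    ∃ (r : k →ₗ⁅ℝ⁆ CurrentExt.SmoothVectorField 𝓘(ℝ, E) M)
      (Φ : LieAlgebra.SemiDirectSum (CurrentExt.CurrentAlgebra 𝓘(ℝ, E) M g) k
        ((CurrentExt.vectorFieldAction 𝓘(ℝ, E) M g).comp r) ≃ₗ⁅ℝ⁆ L),
      -- `Φ` is an isomorphism of extensions, inducing the identity on both ends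
      (∀ f, Φ (LieAlgebra.SemiDirectSum.inl _ f) = i f) ∧
      (∀ z, p (Φ z) = LieAlgebra.SemiDirectSum.projr _ z) ∧
      -- for an extension of topological Lie algebras, `Φ` is moreover a homeomorphism
      (∀ [TopologicalSpace k] [IsTopologicalAddGroup k] [ContinuousSMul ℝ k] [T2Space k]
        [TopologicalSpace L] [IsTopologicalAddGroup L] [ContinuousSMul ℝ L],
        Topology.IsEmbedding i → Continuous p →
          IsHomeomorph (fun q : CurrentExt.CurrentAlgebra 𝓘(ℝ, E) M g × k =>
            Φ (LieAlgebra.SemiDirectSum.toProd.symm q))) := by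
  obtain ⟨r, Φ, hΦi, hΦp⟩ := CurrentExt.exists_semiDirectSum_equiv
    (CurrentExt.vectorFieldAction 𝓘(ℝ, E) M g)
    (CurrentExt.bijective_ad_add_vectorFieldAction hg hgC) hext
  exact ⟨r, Φ, hΦi, hΦp, fun hi hp => CurrentExt.isHomeomorph_of_splitting Φ hΦi hΦp hi hp⟩
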